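/- A \emph{fullerene} is a simple convex $3$-polytope all of whose facets are pentagons and hexagons. The \emph{faces} of a polytope are the intersections of its facets (the polytope itself included), and two polytopes are \emph{combinatorially equivalent} if there is a bijection between their sets of faces that preserves inclusion in both directions. For $k\ge 0$ the combinatorial polytope $D_k$ is obtained from the dodecahedron by cutting its surface along a zigzag cycle into two caps, each a pentagon surrounded by five pentagons, and inserting between the caps $k$ successive cyclic belts of five hexagons, each hexagon meeting its two neighbours in its belt along opposite edges. Explicitly, its facets are $T$, $B$ and $R_{j,i}$ with $0\le j\le k+1$, $i\in\mathbb Z/5$; its $20+10k$ vertices are given by the triples of facets that meet in them, $$\{T,R_{0,i},R_{0,i+1}\},\quad \{R_{j,i},R_{j,i+1},R_{j+1,i}\},\quad \{R_{j,i+1},R_{j+1,i},R_{j+1,i+1}\}\ (0\le j\le k),\quad \{R_{k+1,i},R_{k+1,i+1},B\},$$ where $i\in\mathbb Z/5$; and its faces are the intersections of facets, each regarded as a set of vertices. In particular, $D_0$ is the dodecahedron. \textbf{Theorem.} A fullerene $P$ is combinatorially equivalent to $D_k$ for some $k\ge 0$ if and only if it contains the cap, that is, if and only if $P$ has a pentagonal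 facet $F$ and five pairwise different pentagonal facets $F_0,\dots,F_4$, all different from $F$, such that $F\cap F_i$ and $F_i\cap F_{i+1}$ are edges for all $i\in\mathbb Z/5$. -/

import Mathlib

/-- A convex `n`-polytope in `ℝⁿ`: a bounded set with nonempty interior, given by an irredundant
finite system of inequalities `⟪a i, x⟫ + b i ≥ 0`. -/
structure ConvexPolytope (n : ℕ) where
  /-- the number of inequalities, that is, of facets -/
  m : ℕ
  a : Fin m → EuclideanSpace ℝ (Fin n)
  b : Fin m → ℝ
  bounded : Bornology.IsBounded {x | ∀ i, 0 ≤ inner ℝ (a i) x + b i}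
  irredundant : ∀ i, {x | ∀ j, j ≠ i → 0 ≤ inner ℝ (a j) x + b j} ≠
    {x | ∀ j, 0 ≤ inner ℝ (a j) x + b j}
  fullDim : (interior {x | ∀ i, 0 ≤ inner ℝ (a i) x + b i}).Nonempty

/-- All the intersections of members of the family `F` of subsets of `B`;
the empty intersection is `B`. -/
def facesOf {X ι : Type*} (B : Set X) (F : ι → Set X) : Set (Set X) :=
  {G | ∃ S : Set ι, G = B ∩ ⋂ i ∈ S, F i}

/-- Combinatorial equivalence of two sets of faces: a bijection that preserves inclusion in both
directions. -/
def CombEquiv {X Y : Type*} (A : Set (Set X)) (B : Set (Set Y)) : Prop :=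
  Nonempty (A ≃o B)

namespace ConvexPolytope

variable {n : ℕ}

/-- The underlying set of points. -/
def carrier (P : ConvexPolytope n) : Set (EuclideanSpace ℝ (Fin n)) :=
  {x | ∀ i, 0 ≤ inner ℝ (P.a i) x + P.b i}

/-- The `i`-th facet. -/
def facet (P : ConvexPolytope n) (i : Fin P.m) : Set (EuclideanSpace ℝ (Fin n)) :=
  P.carrier ∩ {x | inner ℝ (P.a i) x + P.b i = 0}

/-- The set of faces, including the polytope itself; the empty set is a face whenever it is an
intersection of facets. -/
def faces (P : ConvexPolytope n) : Set (Set (EuclideanSpace ℝ (Fin n))) :=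
  facesOf P.carrier P.facet

/-- A vertex is a face that consists of one point. -/
def IsVertex (P : ConvexPolytope n) (v : EuclideanSpace ℝ (Fin n)) : Prop :=
  {v} ∈ P.faces

/-- An edge is a one-dimensional face. -/
def IsEdge (P : ConvexPolytope n) (G : Set (EuclideanSpace ℝ (Fin n))) : Prop :=
  G ∈ P.faces ∧ Module.finrank ℝ (vectorSpan ℝ G) = 1

/-- Every vertex lies in exactly `n` facets. -/
def IsSimple (P : ConvexPolytope n) : Prop :=
  ∀ v, P.IsVertex v → {i | v ∈ P.facet i}.ncard = n

/-- The facet `i` of a `3`-polytope is an `s`-gon: it has exactly `s` vertices. -/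
def IsGon (P : ConvexPolytope 3) (s : ℕ) (i : Fin P.m) : Prop :=
  {v | P.IsVertex v ∧ v ∈ P.facet i}.ncard = s

/-- A fullerene: a simple convex `3`-polytope whose facets are pentagons and hexagons. -/
def IsFullerene (P : ConvexPolytope 3) : Prop :=
  P.IsSimple ∧ ∀ i, P.IsGon 5 i ∨ P.IsGon 6 i

/-- The cap: a pentagon `c` surrounded by a simple `5`-loop `p 0, …, p 4` of pentagons. -/
def ContainsCap (P : ConvexPolytope 3) : Prop :=
  ∃ (c : Fin P.m) (p : ZMod 5 → Fin P.m),
    P.IsGon 5 c ∧ (∀ i, P.IsGon 5 (p i)) ∧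
    Function.Injective p ∧ (∀ i, p i ≠ c) ∧
    (∀ i, P.IsEdge (P.facet c ∩ P.facet (p i))) ∧
    (∀ i, P.IsEdge (P.facet (p i) ∩ P.facet (p (i + 1))))

end ConvexPolytope

/-! ### The combinatorial polytopes `D k`

The surface of the dodecahedron is cut along a zigzag cycle into two caps, each a pentagon
surrounded by five pentagons, and `k` successive `5`-belts of hexagons are inserted. So there are
`k + 2` rings of five facets between the two end pentagons: ring `0` and ring `k + 1` consist of
the outer pentagons of the caps, and rings `1, …, k` are the hexagonal belts. Neighbouring rings
meet along a zigzag cycle of length `10`. -/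

/-- The facets of `D k`. -/
inductive DFacet (k : ℕ) : Type
  | top : DFacet k
  | ring (j : Fin (k + 2)) (i : ZMod 5) : DFacet k
  | bottom : DFacet k

/-- The vertices of `D k`: five on each end pentagon, and ten on each of the `k + 1` zigzag
cycles, the cycle `j` lying between the rings `j` and `j + 1`. -/
inductive DVertex (k : ℕ) : Type
  | top (i : ZMod 5) : DVertex k
  | zig (j : Fin (k + 1)) (i : ZMod 5) : DVertex k
  | zag (j : Fin (k + 1)) (i : ZMod 5) : DVertex k
  | bottom (i : ZMod 5) : DVertex k

/-- The three facets that meet at a vertex of `D k`. The facet `i` of ring `j + 1` is adjacent to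
the facets `i` and `i + 1` of ring `j`. -/
def DVertex.facets {k : ℕ} : DVertex k → Set (DFacet k)
  | .top i => {.top, .ring 0 i, .ring 0 (i + 1)}
  | .zig j i => {.ring j.castSucc i, .ring j.castSucc (i + 1), .ring j.succ i}
  | .zag j i => {.ring j.castSucc (i + 1), .ring j.succ i, .ring j.succ (i + 1)}
  | .bottom i => {.ring (Fin.last (k + 1)) i, .ring (Fin.last (k + 1)) (i + 1), .bottom}

/-- The set of vertices of a facet of `D k`. -/
def DFacet.vertices {k : ℕ} (F : DFacet k) : Set (DVertex k) :=
  {v | F ∈ v.facets}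

/-- The faces of `D k`, each given by its set of vertices: the intersections of facets. -/
def DFaces (k : ℕ) : Set (Set (DVertex k)) :=
  facesOf Set.univ (DFacet.vertices (k := k))

/-! A fullerene has no loops of three or four facets except the trivial ones. A loop of five facets
around another one therefore consists of pentagons only or of hexagons only, since a mixed one would
produce a shorter loop further out. So from the cap on, rings of five hexagons surround one another
until, the polytope being finite, a ring of five pentagons comes, and it is closed by a second cap.
This gives an incidence preserving map from `D k` to `P`, a covering, and it has only one sheet
because Euler's formula leaves `P` with just the twelve pentagons of the two caps. Conversely,
vertices and facets are recognized by the inclusions of faces, so that an equivalence with `D k`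
carries the cap of `D k` to `P`.

Euler's formula is the symmetry of the `h`-vector, computed with a linear functional in general
position. -/

theorem mem_facesOf {X ι : Type*} {B G : Set X} {F : ι → Set X} :
    G ∈ facesOf B F ↔ ∃ S : Set ι, ∀ x, x ∈ G ↔ x ∈ B ∧ ∀ i ∈ S, x ∈ F i := by
  simp [facesOf, Set.ext_iff]

namespace ConvexPolytope

section Faces

variable {n : ℕ} {P : ConvexPolytope n} {x y z d v w : EuclideanSpace ℝ (Fin n)} {i j : Fin P.m}
  {G K : Set (EuclideanSpace ℝ (Fin n))}

variable (P) in
/-- The left-hand side of the inequality number `i`; it measures how far `x` is from the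
hyperplane of the facet `i`. -/
noncomputable def slack (i : Fin P.m) (x : EuclideanSpace ℝ (Fin n)) : ℝ :=
  inner ℝ (P.a i) x + P.b i

variable (P) in
/-- The inequalities that are equalities at `x`. For a point of the polytope these are the
facets that contain it. -/
noncomputable def tight (x : EuclideanSpace ℝ (Fin n)) : Finset (Fin P.m) :=
  {i | P.slack i x = 0}

theorem mem_tight : i ∈ P.tight x ↔ P.slack i x = 0 := by simp [tight]

theorem mem_carrier_iff : x ∈ P.carrier ↔ ∀ i, 0 ≤ P.slack i x := Iff.rfl

theorem mem_facet : x ∈ P.facet i ↔ x ∈ P.carrier ∧ i ∈ P.tight x := by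
  rw [mem_tight]; rfl

theorem mem_faces : G ∈ P.faces ↔
    ∃ S : Set (Fin P.m), ∀ x, x ∈ G ↔ x ∈ P.carrier ∧ ∀ i ∈ S, i ∈ P.tight x := by
  simp only [faces, mem_facesOf, mem_facet]
  exact exists_congr fun S => forall_congr' fun x => iff_congr Iff.rfl
    (and_congr_right fun hx => forall₂_congr fun i _ => and_iff_right hx)

theorem slack_add_smul (i : Fin P.m) (x d : EuclideanSpace ℝ (Fin n)) (t : ℝ) :
    P.slack i (x + t • d) = P.slack i x + t * inner ℝ (P.a i) d := by
  simp only [slack, inner_add_right, inner_smul_right]; ring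

theorem slack_smul_add_smul (i : Fin P.m) (x y : EuclideanSpace ℝ (Fin n)) {s t : ℝ}
    (hst : s + t = 1) : P.slack i (s • x + t • y) = s * P.slack i x + t * P.slack i y := by
  obtain rfl : t = 1 - s := by linarith
  simp only [slack, inner_add_right, inner_smul_right]; ring

theorem inner_sub_eq_slack_sub (i : Fin P.m) (x y : EuclideanSpace ℝ (Fin n)) :
    inner ℝ (P.a i) (x - y) = P.slack i x - P.slack i y := by
  simp only [slack, inner_sub_right]; ring

theorem continuous_slack (i : Fin P.m) : Continuous (P.slack i) := by
  unfold slack; fun_prop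

theorem isClosed_carrier : IsClosed P.carrier := by
  simp only [carrier, Set.ofPred_forall]
  exact isClosed_iInter fun i => isClosed_le continuous_const (continuous_slack i)

theorem isClosed_facet (i : Fin P.m) : IsClosed (P.facet i) :=
  isClosed_carrier.inter (isClosed_eq (continuous_slack i) continuous_const)

theorem isCompact_of_mem_faces (hG : G ∈ P.faces) : IsCompact G := by
  obtain ⟨S, rfl⟩ := hG
  exact (Metric.isCompact_of_isClosed_isBounded isClosed_carrier P.bounded).inter_right
    (isClosed_biInter fun i _ => isClosed_facet i)

theorem convex_carrier : Convex ℝ P.carrier := by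
  intro x hx y hy s t hs ht hst
  refine mem_carrier_iff.2 fun i => ?_
  rw [slack_smul_add_smul i x y hst]
  exact add_nonneg (mul_nonneg hs (mem_carrier_iff.1 hx i)) (mul_nonneg ht (mem_carrier_iff.1 hy i))

theorem convex_of_mem_faces (hG : G ∈ P.faces) : Convex ℝ G := by
  obtain ⟨S, hS⟩ := mem_faces.1 hG
  intro x hx y hy s t hs ht hst
  rw [hS] at hx hy ⊢
  refine ⟨convex_carrier hx.1 hy.1 hs ht hst, fun i hi => mem_tight.2 ?_⟩
  rw [slack_smul_add_smul i x y hst, mem_tight.1 (hx.2 i hi), mem_tight.1 (hy.2 i hi)]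
  simp

theorem tight_subset_of_mem_openSegment (hx : x ∈ P.carrier) (hy : y ∈ P.carrier)
    (hz : z ∈ openSegment ℝ x y) : P.tight z ⊆ P.tight x := by
  obtain ⟨s, t, hs, ht, hst, rfl⟩ := hz
  intro i hi
  rw [mem_tight, slack_smul_add_smul i x y hst] at hi
  have hsx := mul_nonneg hs.le (mem_carrier_iff.1 hx i)
  have hty := mul_nonneg ht.le (mem_carrier_iff.1 hy i)
  exact mem_tight.2 ((mul_eq_zero.1 (by linarith)).resolve_left hs.ne')

theorem eventually_add_smul_mem (hG : G ∈ P.faces) (hx : x ∈ G)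
    (hd : ∀ i ∈ P.tight x, inner ℝ (P.a i) d = 0) : ∀ᶠ t : ℝ in nhds 0, x + t • d ∈ G := by
  obtain ⟨S, hS⟩ := mem_faces.1 hG
  obtain ⟨hxc, hxS⟩ := (hS x).1 hx
  have hconst : ∀ i ∈ P.tight x, ∀ t : ℝ, P.slack i (x + t • d) = 0 := fun i hi t => by
    rw [slack_add_smul, hd i hi, mul_zero, add_zero, mem_tight.1 hi]
  have hcarrier : ∀ᶠ t : ℝ in nhds 0, x + t • d ∈ P.carrier := by
    refine Filter.eventually_all.2 fun i => ?_
    rcases (mem_carrier_iff.1 hxc i).eq_or_lt with h | h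
    · exact .of_forall fun t => (hconst i (mem_tight.2 h.symm) t).ge
    · have hcont : Continuous fun t : ℝ => P.slack i (x + t • d) := by
        simp only [slack_add_smul]; fun_prop
      exact ((hcont.tendsto 0).eventually (lt_mem_nhds (by simpa using h))).mono fun t => le_of_lt
  exact hcarrier.mono fun t ht =>
    (hS _).2 ⟨ht, fun i hi => mem_tight.2 (hconst i (hxS i hi) t)⟩

theorem exists_pos_add_mem_and_sub_mem (hG : G ∈ P.faces) (hx : x ∈ G)
    (hd : ∀ i ∈ P.tight x, inner ℝ (P.a i) d = 0) :
    ∃ ε : ℝ, 0 < ε ∧ x + ε • d ∈ G ∧ x - ε • d ∈ G := by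
  obtain ⟨ε, hε, h⟩ := Metric.eventually_nhds_iff.1 (eventually_add_smul_mem hG hx hd)
  refine ⟨ε / 2, half_pos hε, h ?_, ?_⟩
  · simpa [abs_of_pos hε] using half_lt_self hε
  · rw [sub_eq_add_neg, ← neg_smul]
    exact h (by simpa [abs_of_pos hε] using half_lt_self hε)

theorem isVertex_iff : P.IsVertex v ↔
    v ∈ P.carrier ∧ ∀ d, (∀ i ∈ P.tight v, inner ℝ (P.a i) d = 0) → d = 0 := by
  constructor
  · intro hv
    refine ⟨?_, fun d hd => ?_⟩
    · obtain ⟨S, hS⟩ := mem_faces.1 hv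
      exact ((hS v).1 rfl).1
    · obtain ⟨ε, hε, hmem, -⟩ := exists_pos_add_mem_and_sub_mem hv rfl hd
      simpa [hε.ne'] using hmem
  · rintro ⟨hv, hrigid⟩
    refine mem_faces.2 ⟨P.tight v, fun x => ?_⟩
    rw [Set.mem_singleton_iff]
    constructor
    · rintro rfl
      exact ⟨hv, fun _ hi => hi⟩
    · rintro ⟨-, hx⟩
      refine sub_eq_zero.1 (hrigid _ fun i hi => ?_)
      rw [inner_sub_eq_slack_sub, mem_tight.1 hi, mem_tight.1 (hx i hi), sub_zero]

theorem IsVertex.mem_carrier (hv : P.IsVertex v) : v ∈ P.carrier := (isVertex_iff.1 hv).1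

theorem IsVertex.eq_zero (hv : P.IsVertex v) (hd : ∀ i ∈ P.tight v, inner ℝ (P.a i) d = 0) :
    d = 0 := (isVertex_iff.1 hv).2 d hd

theorem IsVertex.eq_of_tight_subset (hv : P.IsVertex v) (h : P.tight v ⊆ P.tight w) : w = v := by
  refine sub_eq_zero.1 (hv.eq_zero fun i hi => ?_)
  rw [inner_sub_eq_slack_sub, mem_tight.1 hi, mem_tight.1 (h hi), sub_zero]

variable (P) in
/-- The vertices of a polytope. -/
abbrev Vertex : Type := {v // P.IsVertex v}

instance : Finite P.Vertex :=
  Finite.of_injective (fun v : P.Vertex => P.tight v) fun v _ h =>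
    (Subtype.ext (v.2.eq_of_tight_subset h.subset)).symm

noncomputable instance : Fintype P.Vertex := Fintype.ofFinite _

theorem isVertex_of_mem_extremePoints (hG : G ∈ P.faces) (hx : x ∈ G.extremePoints ℝ) :
    P.IsVertex x := by
  obtain ⟨S, hS⟩ := mem_faces.1 hG
  refine isVertex_iff.2 ⟨((hS x).1 hx.1).1, fun d hd => ?_⟩
  obtain ⟨ε, hε, hadd, hsub⟩ := exists_pos_add_mem_and_sub_mem hG hx.1 hd
  have hmid : x ∈ openSegment ℝ (x + ε • d) (x - ε • d) :=
    ⟨1 / 2, 1 / 2, by norm_num, by norm_num, by norm_num, by module⟩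
  simpa [hε.ne'] using hx.2 hadd hsub hmid

theorem exists_vertex_mem_of_mem_faces (hG : G ∈ P.faces) (hne : G.Nonempty) :
    ∃ v : P.Vertex, (v : EuclideanSpace ℝ (Fin n)) ∈ G := by
  obtain ⟨x, hx⟩ := (isCompact_of_mem_faces hG).extremePoints_nonempty hne
  exact ⟨⟨x, isVertex_of_mem_extremePoints hG hx⟩, hx.1⟩

theorem subset_iff_forall_vertex (hG : G ∈ P.faces) (hK : K ∈ P.faces) :
    G ⊆ K ↔ ∀ v : P.Vertex, v.1 ∈ G → v.1 ∈ K := by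
  refine ⟨fun h v hv => h hv, fun h => ?_⟩
  rw [← closure_convexHull_extremePoints (isCompact_of_mem_faces hG) (convex_of_mem_faces hG)]
  refine closure_minimal (convexHull_min (fun x hx => ?_) (convex_of_mem_faces hK))
    (isCompact_of_mem_faces hK).isClosed
  exact h ⟨x, isVertex_of_mem_extremePoints hG hx⟩ hx.1

variable (P) in
theorem combEquiv_vertices :
    CombEquiv P.faces (facesOf Set.univ fun i => {v : P.Vertex | i ∈ P.tight v}) := by
  have hvertices : ∀ S : Set (Fin P.m),
      {v : P.Vertex | (v : EuclideanSpace ℝ (Fin n)) ∈ P.carrier ∩ ⋂ i ∈ S, P.facet i} =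
        Set.univ ∩ ⋂ i ∈ S, {v : P.Vertex | i ∈ P.tight v} := by
    intro S
    ext v
    simp [mem_facet, v.2.mem_carrier]
  refine ⟨RelIso.ofSurjective (OrderEmbedding.ofMapLEIff (fun G : P.faces =>
    (⟨{v : P.Vertex | (v : EuclideanSpace ℝ (Fin n)) ∈ G.1}, ?_⟩ :
      facesOf Set.univ fun i => {v : P.Vertex | i ∈ P.tight v})) ?_) ?_⟩
  · obtain ⟨S, hS⟩ := G.2
    exact ⟨S, by rw [hS, hvertices]⟩
  · exact fun G K => (subset_iff_forall_vertex G.2 K.2).symm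
  · rintro ⟨_, S, rfl⟩
    exact ⟨⟨_, S, rfl⟩, Subtype.ext (hvertices S)⟩

variable (P) in
theorem carrier_nonempty : P.carrier.Nonempty := P.fullDim.mono interior_subset

theorem carrier_mem_faces : P.carrier ∈ P.faces := mem_faces.2 ⟨∅, by simp⟩

instance : Nonempty P.Vertex :=
  (exists_vertex_mem_of_mem_faces carrier_mem_faces P.carrier_nonempty).nonempty

theorem facet_mem_faces (i : Fin P.m) : P.facet i ∈ P.faces :=
  mem_faces.2 ⟨{i}, by simp [mem_facet]⟩

theorem facet_nonempty (i : Fin P.m) : (P.facet i).Nonempty := by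
  obtain ⟨y, hy, hyi⟩ : ∃ y, (∀ j, j ≠ i → 0 ≤ P.slack j y) ∧ P.slack i y < 0 := by
    by_contra! h
    refine P.irredundant i (Set.Subset.antisymm (fun y hy j => ?_) fun y hy j _ => hy j)
    by_cases hj : j = i
    · exact hj ▸ h y hy
    · exact hy j hj
  obtain ⟨x, hx⟩ := P.carrier_nonempty
  have hzero : 0 ∈ segment ℝ (P.slack i y) (P.slack i x) :=
    Icc_subset_segment ⟨hyi.le, hx i⟩
  obtain ⟨s, t, hs, ht, hst, hzero⟩ := hzero
  rw [smul_eq_mul, smul_eq_mul, ← slack_smul_add_smul i y x hst] at hzero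
  refine ⟨_, mem_facet.2 ⟨mem_carrier_iff.2 fun j => ?_, mem_tight.2 hzero⟩⟩
  by_cases hj : j = i
  · exact hj ▸ hzero.ge
  · rw [slack_smul_add_smul j y x hst]
    exact add_nonneg (mul_nonneg hs (hy j hj)) (mul_nonneg ht (hx j))

theorem exists_vertex_mem_tight (i : Fin P.m) : ∃ v : P.Vertex, i ∈ P.tight v :=
  (exists_vertex_mem_of_mem_faces (facet_mem_faces i) (facet_nonempty i)).imp
    fun _ hv => (mem_facet.1 hv).2

theorem IsEdge.nonempty (h : P.IsEdge G) : G.Nonempty := by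
  rw [Set.nonempty_iff_ne_empty]
  rintro rfl
  have := h.2
  rw [vectorSpan_empty, finrank_bot] at this
  exact zero_ne_one this

theorem IsEdge.exists_vertex (h : P.IsEdge (P.facet i ∩ P.facet j)) :
    ∃ v : P.Vertex, i ∈ P.tight v ∧ j ∈ P.tight v :=
  (exists_vertex_mem_of_mem_faces h.1 h.nonempty).imp
    fun _ hv => ⟨(mem_facet.1 hv.1).2, (mem_facet.1 hv.2).2⟩

theorem exists_inner_neg (hx : x ∈ P.carrier) (hd : d ≠ 0) : ∃ j, inner ℝ (P.a j) d < 0 := by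
  by_contra! h
  obtain ⟨C, hC⟩ := P.bounded.exists_norm_le
  have hray : ∀ t : ℝ, 0 ≤ t → t * ‖d‖ ≤ C + ‖x‖ := by
    intro t ht
    have hmem : x + t • d ∈ P.carrier := mem_carrier_iff.2 fun i => by
      rw [slack_add_smul]
      exact add_nonneg (mem_carrier_iff.1 hx i) (mul_nonneg ht (h i))
    calc t * ‖d‖ = ‖(x + t • d) - x‖ := by
          rw [add_sub_cancel_left, norm_smul, Real.norm_of_nonneg ht]
      _ ≤ ‖x + t • d‖ + ‖x‖ := norm_sub_le _ _
      _ ≤ C + ‖x‖ := by gcongr; exact hC _ hmem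
  have hd' : 0 < ‖d‖ := norm_pos_iff.2 hd
  have hC0 : 0 ≤ C + ‖x‖ := by simpa using hray 0 le_rfl
  have := hray ((C + ‖x‖ + 1) / ‖d‖) (by positivity)
  rw [div_mul_cancel₀ _ hd'.ne'] at this
  linarith

theorem exists_exit_point (hx : x ∈ P.carrier) (hd : d ≠ 0)
    (hin : ∀ j ∈ P.tight x, 0 ≤ inner ℝ (P.a j) d) :
    ∃ t : ℝ, 0 < t ∧ x + t • d ∈ P.carrier ∧ ∃ k ∈ P.tight (x + t • d), inner ℝ (P.a k) d < 0 := by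
  obtain ⟨j₀, hj₀⟩ := exists_inner_neg hx hd
  obtain ⟨k, hk, hmin⟩ := Finset.exists_min_image ({j | inner ℝ (P.a j) d < 0} : Finset (Fin P.m))
    (fun j => P.slack j x / -inner ℝ (P.a j) d) ⟨j₀, by simpa using hj₀⟩
  simp only [Finset.mem_filter, Finset.mem_univ, true_and] at hk hmin
  have hkx : 0 < P.slack k x :=
    (mem_carrier_iff.1 hx k).lt_of_ne fun h => (hin k (mem_tight.2 h.symm)).not_gt hk
  have ht : 0 < P.slack k x / -inner ℝ (P.a k) d := div_pos hkx (neg_pos.2 hk)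
  refine ⟨_, ht, mem_carrier_iff.2 fun j => ?_, k, mem_tight.2 ?_, hk⟩
  · rw [slack_add_smul]
    rcases lt_or_ge (inner ℝ (P.a j) d) 0 with hj | hj
    · have := (le_div_iff₀ (neg_pos.2 hj)).1 (hmin j hj)
      linarith
    · exact add_nonneg (mem_carrier_iff.1 hx j) (mul_nonneg ht.le hj)
  · rw [slack_add_smul]
    have := hk.ne
    field_simp
    ring

theorem IsVertex.exists_functional_lt (hw : P.IsVertex w) :
    ∃ l : EuclideanSpace ℝ (Fin n) →ₗ[ℝ] ℝ, ∀ x ∈ P.carrier, x ≠ w → l x < l w := by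
  refine ⟨-∑ i ∈ P.tight w, (innerSL ℝ (P.a i)).toLinearMap, fun x hx hne => ?_⟩
  rw [← sub_pos, ← map_sub, ← neg_sub x w, LinearMap.neg_apply, map_neg, neg_neg]
  simp only [LinearMap.sum_apply, ContinuousLinearMap.coe_coe, innerSL_apply_apply,
    inner_sub_eq_slack_sub]
  have hterm : ∀ i ∈ P.tight w, P.slack i x - P.slack i w = P.slack i x := fun i hi => by
    rw [mem_tight.1 hi, sub_zero]
  rw [Finset.sum_congr rfl hterm]
  refine Finset.sum_pos' (fun i _ => mem_carrier_iff.1 hx i) ?_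
  by_contra! hle
  exact hne (hw.eq_of_tight_subset fun i hi =>
    mem_tight.2 ((hle i hi).antisymm (mem_carrier_iff.1 hx i)))

end Faces

end ConvexPolytope

namespace ConvexPolytope

section Simple

variable {n : ℕ} {P : ConvexPolytope n} {v w w' : P.Vertex} {i : Fin P.m}
  {x : EuclideanSpace ℝ (Fin n)}

theorem IsSimple.card_tight (hs : P.IsSimple) (v : P.Vertex) : (P.tight v).card = n := by
  refine Eq.trans ?_ (hs v v.2)
  rw [← Set.ncard_coe_finset]
  congr 1
  ext i
  simp [mem_facet, v.2.mem_carrier]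

theorem IsSimple.exists_inner_eq_ite (hs : P.IsSimple) (v : P.Vertex) (i : Fin P.m) :
    ∃ d : EuclideanSpace ℝ (Fin n),
      ∀ j ∈ P.tight v, inner ℝ (P.a j) d = if j = i then 1 else 0 := by
  let f : EuclideanSpace ℝ (Fin n) →ₗ[ℝ] (P.tight v → ℝ) :=
    LinearMap.pi fun j => (innerSL ℝ (P.a j)).toLinearMap
  have hinj : Function.Injective f := (injective_iff_map_eq_zero f).2 fun d hd =>
    v.2.eq_zero fun j hj => congrFun hd ⟨j, hj⟩
  have hsurj : Function.Surjective f :=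
    (LinearMap.injective_iff_surjective_of_finrank_eq_finrank (by simp [hs.card_tight v])).1 hinj
  obtain ⟨d, hd⟩ := hsurj fun j => if j.1 = i then 1 else 0
  exact ⟨d, fun j hj => congrFun hd ⟨j, hj⟩⟩

/-- At a vertex `v` of a simple polytope, the direction of the edge that leaves the facet `i`. -/
noncomputable def IsSimple.dir (hs : P.IsSimple) (v : P.Vertex) (i : Fin P.m) :
    EuclideanSpace ℝ (Fin n) :=
  (hs.exists_inner_eq_ite v i).choose

theorem IsSimple.inner_dir (hs : P.IsSimple) {j : Fin P.m} (hj : j ∈ P.tight v) :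
    inner ℝ (P.a j) (hs.dir v i) = if j = i then 1 else 0 :=
  (hs.exists_inner_eq_ite v i).choose_spec j hj

theorem IsSimple.dir_ne_zero (hs : P.IsSimple) (hi : i ∈ P.tight v) : hs.dir v i ≠ 0 := by
  intro h
  have := hs.inner_dir (i := i) hi
  rw [h, inner_zero_right, if_pos rfl] at this
  exact zero_ne_one this

theorem IsSimple.sub_eq_sum (hs : P.IsSimple) (v : P.Vertex) (x : EuclideanSpace ℝ (Fin n)) :
    x - v = ∑ i ∈ P.tight v, P.slack i x • hs.dir v i := by
  refine sub_eq_zero.1 (v.2.eq_zero fun j hj => ?_)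
  rw [inner_sub_right, inner_sub_eq_slack_sub, mem_tight.1 hj, inner_sum]
  simp only [inner_smul_right, hs.inner_dir hj]
  simp [hj]

theorem IsSimple.eq_add_smul_dir (hs : P.IsSimple) (hi : i ∈ P.tight v)
    (hx : P.tight v \ P.tight x ⊆ {i}) : x = v + P.slack i x • hs.dir v i := by
  rw [← sub_eq_iff_eq_add', hs.sub_eq_sum v x]
  refine Finset.sum_eq_single i (fun j hj hji => ?_) (absurd hi)
  have hjx : j ∈ P.tight x := by
    by_contra h
    exact hji (Finset.mem_singleton.1 (hx (Finset.mem_sdiff.2 ⟨hj, h⟩)))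
  rw [mem_tight.1 hjx, zero_smul]

theorem IsSimple.tight_sdiff_add_smul_dir (hs : P.IsSimple) (hi : i ∈ P.tight v) {t : ℝ}
    (ht : t ≠ 0) : P.tight v \ P.tight (v + t • hs.dir v i) = {i} := by
  have hslack : ∀ j ∈ P.tight v,
      P.slack j (v + t • hs.dir v i) = if j = i then t else 0 := fun j hj => by
    rw [slack_add_smul, mem_tight.1 hj, hs.inner_dir hj, mul_ite, mul_one, mul_zero, zero_add]
  ext j
  rw [Finset.mem_sdiff, Finset.mem_singleton, mem_tight (x := _ + _)]
  constructor
  · rintro ⟨hj, hne⟩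
    by_contra hji
    exact hne (by rw [hslack j hj, if_neg hji])
  · rintro rfl
    exact ⟨hi, by rwa [hslack j hi, if_pos rfl]⟩

theorem IsSimple.exists_nbr (hs : P.IsSimple) (hi : i ∈ P.tight v) :
    ∃ (w : P.Vertex) (t : ℝ), 0 < t ∧ w = v + t • hs.dir v i ∧
      P.tight v \ P.tight w = {i} := by
  obtain ⟨t, ht, hcarrier, k, hk, hkneg⟩ := exists_exit_point v.2.mem_carrier
    (hs.dir_ne_zero hi) fun j hj => by rw [hs.inner_dir hj]; split_ifs <;> norm_num
  have hsdiff := hs.tight_sdiff_add_smul_dir hi ht.ne'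
  refine ⟨⟨_, isVertex_iff.2 ⟨hcarrier, fun d hd => ?_⟩⟩, t, ht, rfl, hsdiff⟩
  have hvd : P.tight v \ P.tight (v + d) ⊆ {i} := by
    refine hsdiff ▸ fun j hj => ?_
    obtain ⟨hjv, hjd⟩ := Finset.mem_sdiff.1 hj
    refine Finset.mem_sdiff.2 ⟨hjv, fun hjt => hjd (mem_tight.2 ?_)⟩
    rw [← one_smul ℝ d, slack_add_smul, mem_tight.1 hjv, hd j hjt, mul_zero, add_zero]
  have hdir := add_left_cancel (hs.eq_add_smul_dir hi hvd)
  have hinner := hd k hk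
  rw [hdir, inner_smul_right] at hinner
  rw [hdir, (mul_eq_zero.1 hinner).resolve_right hkneg.ne, zero_smul]

theorem IsSimple.eq_of_tight_sdiff_eq (hs : P.IsSimple) (h : P.tight v \ P.tight w = {i})
    (h' : P.tight v \ P.tight w' = {i}) : w = w' := by
  wlog hle : P.slack i w ≤ P.slack i w' generalizing w w'
  · exact (this h' h (le_of_not_ge hle)).symm
  obtain ⟨hiv, hiw⟩ := Finset.mem_sdiff.1 (h.ge (Finset.mem_singleton_self i))
  have hw := hs.eq_add_smul_dir hiv h.le
  have hw' := hs.eq_add_smul_dir hiv h'.le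
  have hpos : 0 < P.slack i w := (mem_carrier_iff.1 w.2.mem_carrier i).lt_of_ne fun h0 =>
    hiw (mem_tight.2 h0.symm)
  rcases hle.eq_or_lt with heq | hlt
  · exact Subtype.ext (by rw [hw, hw', heq])
  have hpos' := hpos.trans hlt
  have hbetween : w.1 ∈ openSegment ℝ v.1 w'.1 := by
    rw [openSegment_eq_image']
    refine ⟨P.slack i w / P.slack i w', ⟨div_pos hpos hpos', (div_lt_one hpos').2 hlt⟩, ?_⟩
    change v.1 + _ • (w'.1 - v.1) = w
    rw [← eq_sub_of_add_eq' hw'.symm, smul_smul, div_mul_cancel₀ _ hpos'.ne', ← hw]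
  have := w.2.eq_of_tight_subset
    (tight_subset_of_mem_openSegment v.2.mem_carrier w'.2.mem_carrier hbetween)
  exact (hiw (this ▸ hiv)).elim

theorem IsSimple.existsUnique_nbr (hs : P.IsSimple) (hi : i ∈ P.tight v) :
    ∃! w : P.Vertex, P.tight v \ P.tight w = {i} := by
  obtain ⟨w, -, -, -, hw⟩ := hs.exists_nbr hi
  exact ⟨w, hw, fun _ hw' => hs.eq_of_tight_sdiff_eq hw' hw⟩

theorem IsSimple.exists_dir_pos (hs : P.IsSimple) (hx : x ∈ P.carrier)
    {l : EuclideanSpace ℝ (Fin n) →ₗ[ℝ] ℝ} (hl : l v < l x) :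
    ∃ i ∈ P.tight v \ P.tight x, 0 < l (hs.dir v i) := by
  have hpos : 0 < l (x - v) := by rwa [map_sub, sub_pos]
  rw [hs.sub_eq_sum v, map_sum] at hpos
  simp only [map_smul, smul_eq_mul] at hpos
  obtain ⟨i, hi, hli⟩ := Finset.exists_lt_of_sum_lt (f := fun _ => (0 : ℝ)) (by simpa using hpos)
  refine ⟨i, Finset.mem_sdiff.2 ⟨hi, fun h => ?_⟩,
    pos_of_mul_pos_right hli (mem_carrier_iff.1 hx i)⟩
  rw [mem_tight.1 h, zero_mul] at hli
  exact hli.false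

theorem IsSimple.reflTransGen_nbr (hs : P.IsSimple) (v w : P.Vertex) :
    Relation.ReflTransGen (fun u u' : P.Vertex =>
      (∃ i, P.tight u \ P.tight u' = {i}) ∧ P.tight v ∩ P.tight w ⊆ P.tight u') v w := by
  classical
  set r := fun u u' : P.Vertex =>
    (∃ i, P.tight u \ P.tight u' = {i}) ∧ P.tight v ∩ P.tight w ⊆ P.tight u'
  obtain ⟨l, hl⟩ := w.2.exists_functional_lt
  obtain ⟨u, hu, hmax⟩ := Finset.exists_max_image
    ({u | Relation.ReflTransGen r v u} : Finset P.Vertex) (fun u => l u)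
    ⟨v, by simp [Relation.ReflTransGen.refl]⟩
  simp only [Finset.mem_filter, Finset.mem_univ, true_and] at hu hmax
  have hface : P.tight v ∩ P.tight w ⊆ P.tight u :=
    hu.cases_tail.elim (fun h => h ▸ Finset.inter_subset_left) fun ⟨_, _, h⟩ => h.2
  by_cases huw : u = w
  · exact huw ▸ hu
  obtain ⟨i, hi, hpos⟩ := hs.exists_dir_pos w.2.mem_carrier
    (hl u u.2.mem_carrier fun h => huw (Subtype.ext h))
  rw [Finset.mem_sdiff] at hi
  obtain ⟨u', t, ht, hu', hsdiff⟩ := hs.exists_nbr hi.1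
  have hface' : P.tight v ∩ P.tight w ⊆ P.tight u' := fun j hj => by
    by_contra hju'
    obtain rfl := Finset.mem_singleton.1 (hsdiff.le (Finset.mem_sdiff.2 ⟨hface hj, hju'⟩))
    exact hi.2 (Finset.mem_inter.1 hj).2
  have hle := hmax u' (hu.tail ⟨⟨i, hsdiff⟩, hface'⟩)
  rw [hu', map_add, map_smul, smul_eq_mul] at hle
  exact absurd (mul_pos ht hpos) (by linarith)

theorem IsSimple.isEdge_of_mem_tight (hs : P.IsSimple) (hi : i ∈ P.tight v) :
    P.IsEdge (P.carrier ∩ ⋂ j ∈ ((P.tight v).erase i : Set (Fin P.m)), P.facet j) := by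
  set G := P.carrier ∩ ⋂ j ∈ ((P.tight v).erase i : Set (Fin P.m)), P.facet j with hG
  have hmem : ∀ x, x ∈ G ↔ x ∈ P.carrier ∧ P.tight v \ P.tight x ⊆ {i} := by
    intro x
    simp only [hG, Set.mem_inter_iff, Set.mem_iInter, mem_facet, Finset.mem_coe,
      Finset.mem_erase, Finset.subset_iff, Finset.mem_sdiff, Finset.mem_singleton]
    grind
  refine ⟨⟨_, rfl⟩, ?_⟩
  suffices vectorSpan ℝ G = Submodule.span ℝ {hs.dir v i} by
    rw [this, finrank_span_singleton (hs.dir_ne_zero hi)]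
  apply le_antisymm
  · rw [vectorSpan_def, Submodule.span_le]
    rintro _ ⟨x, hx, y, hy, rfl⟩
    have hxd := hs.eq_add_smul_dir hi ((hmem x).1 hx).2
    have hyd := hs.eq_add_smul_dir hi ((hmem y).1 hy).2
    refine Submodule.mem_span_singleton.2 ⟨P.slack i x - P.slack i y, ?_⟩
    rw [sub_smul, eq_sub_of_add_eq' hxd.symm, eq_sub_of_add_eq' hyd.symm,
      sub_sub_sub_cancel_right]
    rfl
  · rw [Submodule.span_singleton_le_iff_mem]
    obtain ⟨w, t, ht, hw, hsdiff⟩ := hs.exists_nbr hi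
    have hdir := vsub_mem_vectorSpan ℝ ((hmem w).2 ⟨w.2.mem_carrier, hsdiff.le⟩)
      ((hmem v).2 ⟨v.2.mem_carrier, by simp⟩)
    rw [vsub_eq_sub, hw, add_sub_cancel_left] at hdir
    exact (Submodule.smul_mem_iff _ ht.ne').1 hdir

end Simple

end ConvexPolytope

theorem card_filter_erase_subset {α : Type*} [DecidableEq α] {s t : Finset α} (hts : t ⊆ s) :
    (s.filter fun a => s.erase a ⊆ t).card =
      (if t.card + 1 = s.card then 1 else 0) + if t.card = s.card then s.card else 0 := by
  rcases hts.eq_or_ssubset with rfl | hssub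
  · simp [Finset.erase_subset]
  rw [if_neg (Finset.card_lt_card hssub).ne, add_zero]
  have hiff : ∀ a, s.erase a ⊆ t ↔ s \ t = {a} := fun a => by
    constructor
    · intro h
      refine (Finset.sdiff_nonempty.2 hssub.2).subset_singleton_iff.1 fun b hb => ?_
      rw [Finset.mem_sdiff] at hb
      exact Finset.mem_singleton.2 (by_contra fun hba => hb.2 (h (Finset.mem_erase.2 ⟨hba, hb.1⟩)))
    · intro h b hb
      rw [Finset.mem_erase] at hb
      by_contra hbt
      exact hb.1 (Finset.mem_singleton.1 (h ▸ Finset.mem_sdiff.2 ⟨hb.2, hbt⟩))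
  rw [Finset.filter_congr fun a _ => hiff a]
  have hcard := Finset.card_sdiff_add_card_eq_card hts
  split_ifs with h
  · obtain ⟨a, ha⟩ := Finset.card_eq_one.1 (show (s \ t).card = 1 by omega)
    rw [Finset.card_eq_one]
    refine ⟨a, Finset.ext fun b => ?_⟩
    simp only [ha, Finset.mem_filter, Finset.mem_singleton, Finset.singleton_inj]
    have has : a ∈ s := (Finset.mem_sdiff.1 (ha ▸ Finset.mem_singleton_self a)).1
    exact ⟨fun hb => hb.2.symm, fun hb => ⟨hb ▸ has, hb.symm⟩⟩
  · refine Finset.card_eq_zero.2 (Finset.filter_eq_empty_iff.2 fun a _ ha => h ?_)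
    rw [ha, Finset.card_singleton] at hcard
    omega

namespace ConvexPolytope

section HVector

variable {n : ℕ} {P : ConvexPolytope n} {v : P.Vertex} {i : Fin P.m}
  {l : EuclideanSpace ℝ (Fin n) →ₗ[ℝ] ℝ}

variable (P) in
/-- A linear functional in general position: it takes different values at different vertices. -/
def IsGeneric (l : EuclideanSpace ℝ (Fin n) →ₗ[ℝ] ℝ) : Prop :=
  Function.Injective fun v : P.Vertex => l v

variable (P) in
theorem exists_isGeneric : ∃ l, P.IsGeneric l := by
  obtain ⟨l, hl⟩ := Module.exists_dual_forall_apply_ne_zero (K := ℝ)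
    (fun p : {p : P.Vertex × P.Vertex // p.1 ≠ p.2} => p.1.1.1 - p.1.2.1)
    (fun p h => p.2 (Subtype.ext (sub_eq_zero.1 h)))
  refine ⟨l, fun v w hvw => ?_⟩
  by_contra hne
  exact hl ⟨(v, w), hne⟩ (by rw [map_sub, sub_eq_zero]; exact hvw)

theorem IsGeneric.neg (hl : P.IsGeneric l) : P.IsGeneric (-l) :=
  fun _ _ h => hl (neg_injective h)

/-- The facets at `v` that are left by the edges along which `l` decreases. -/
noncomputable def IsSimple.downFacets (hs : P.IsSimple)
    (l : EuclideanSpace ℝ (Fin n) →ₗ[ℝ] ℝ) (v : P.Vertex) : Finset (Fin P.m) :=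
  {i ∈ P.tight v | l (hs.dir v i) < 0}

/-- The entry number `k` of the `h`-vector, computed with the functional `l`: the number of
vertices with exactly `k` descending edges. -/
noncomputable def IsSimple.hNumber (hs : P.IsSimple) (l : EuclideanSpace ℝ (Fin n) →ₗ[ℝ] ℝ)
    (k : ℕ) : ℕ :=
  ({v | (hs.downFacets l v).card = k} : Finset P.Vertex).card

theorem IsSimple.downFacets_subset (hs : P.IsSimple) : hs.downFacets l v ⊆ P.tight v :=
  Finset.filter_subset _ _

theorem IsGeneric.apply_dir_ne_zero (hl : P.IsGeneric l) (hs : P.IsSimple) (hi : i ∈ P.tight v) :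
    l (hs.dir v i) ≠ 0 := by
  intro h0
  obtain ⟨w, t, -, hw, hsdiff⟩ := hs.exists_nbr hi
  obtain rfl : w = v := hl (by simp [hw, h0])
  simp at hsdiff

theorem IsGeneric.downFacets_neg (hl : P.IsGeneric l) (hs : P.IsSimple) :
    hs.downFacets (-l) v = P.tight v \ hs.downFacets l v := by
  rw [IsSimple.downFacets, IsSimple.downFacets, ← Finset.filter_not]
  refine Finset.filter_congr fun i hi => ?_
  rw [LinearMap.neg_apply, neg_lt_zero, not_lt]
  exact ⟨le_of_lt, fun h => h.lt_of_ne (hl.apply_dir_ne_zero hs hi).symm⟩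

theorem IsGeneric.existsUnique_top (hl : P.IsGeneric l) (hs : P.IsSimple) {S : Finset (Fin P.m)}
    (hS : ∃ v : P.Vertex, S ⊆ P.tight v) :
    ∃! v : P.Vertex, S ⊆ P.tight v ∧ P.tight v \ S ⊆ hs.downFacets l v := by
  obtain ⟨v₀, hv₀⟩ := hS
  obtain ⟨v, hv, hmax⟩ := Finset.exists_max_image ({u | S ⊆ P.tight u} : Finset P.Vertex)
    (fun u => l u) ⟨v₀, by simpa⟩
  simp only [Finset.mem_filter, Finset.mem_univ, true_and] at hv hmax
  refine ⟨v, ⟨hv, fun i hi => ?_⟩, fun w ⟨hw, hdown⟩ => ?_⟩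
  · obtain ⟨hiv, hiS⟩ := Finset.mem_sdiff.1 hi
    obtain ⟨w, t, ht, hw, hsdiff⟩ := hs.exists_nbr hiv
    have hSw : S ⊆ P.tight w := fun j hj => by
      by_contra hjw
      obtain rfl := Finset.mem_singleton.1 (hsdiff.le (Finset.mem_sdiff.2 ⟨hv hj, hjw⟩))
      exact hiS hj
    have hle := hmax w hSw
    rw [hw, map_add, map_smul, smul_eq_mul, add_le_iff_nonpos_right] at hle
    exact Finset.mem_filter.2 ⟨hiv,
      (nonpos_of_mul_nonpos_right hle ht).lt_of_ne (hl.apply_dir_ne_zero hs hiv)⟩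
  · by_contra hne
    obtain ⟨i, hi, hpos⟩ := hs.exists_dir_pos v.2.mem_carrier
      ((hmax w hw).lt_of_ne fun h => hne (hl h))
    obtain ⟨hiw, hiv⟩ := Finset.mem_sdiff.1 hi
    have := hdown (Finset.mem_sdiff.2 ⟨hiw, fun hiS => hiv (hv hiS)⟩)
    exact hpos.not_gt (Finset.mem_filter.1 this).2

theorem IsGeneric.hNumber_dim (hl : P.IsGeneric l) (hs : P.IsSimple) : hs.hNumber l n = 1 := by
  obtain ⟨v, hv, huniq⟩ := hl.existsUnique_top hs (S := ∅) ⟨Classical.arbitrary _, by simp⟩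
  refine Finset.card_eq_one.2 ⟨v, Finset.ext fun w => ?_⟩
  have hiff : (hs.downFacets l w).card = n ↔ P.tight w \ ∅ ⊆ hs.downFacets l w := by
    rw [Finset.sdiff_empty]
    refine ⟨fun h => ?_, fun h => ?_⟩
    · exact (Finset.eq_of_subset_of_card_le hs.downFacets_subset (by rw [h, hs.card_tight])).ge
    · rw [hs.downFacets_subset.antisymm h, hs.card_tight]
  rw [Finset.mem_filter_univ, Finset.mem_singleton, hiff]
  exact ⟨fun h => huniq w ⟨Finset.empty_subset _, h⟩, fun h => h ▸ hv.2⟩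

theorem IsGeneric.hNumber_neg (hl : P.IsGeneric l) (hs : P.IsSimple) {j k : ℕ} (hjk : j + k = n) :
    hs.hNumber (-l) k = hs.hNumber l j := by
  refine congrArg _ (Finset.filter_congr fun v _ => ?_)
  have hcard := Finset.card_sdiff_add_card_eq_card (hs.downFacets_subset (l := l) (v := v))
  rw [hs.card_tight v] at hcard
  rw [hl.downFacets_neg hs]
  omega

/-- Every facet has exactly one highest vertex; a vertex with `n - 1` descending edges is the
highest vertex of one facet, and the vertex with `n` of them is the highest one of `n` facets. -/
theorem IsGeneric.hNumber_add_dim (hl : P.IsGeneric l) (hs : P.IsSimple) {k : ℕ}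
    (hk : k + 1 = n) : hs.hNumber l k + n = P.m := by
  have htops : ∀ i, ({v | i ∈ P.tight v ∧ (P.tight v).erase i ⊆ hs.downFacets l v} :
      Finset P.Vertex).card = 1 := fun i => by
    obtain ⟨v, hv, huniq⟩ := hl.existsUnique_top hs (S := {i})
      (by simpa using exists_vertex_mem_tight i)
    simp only [Finset.singleton_subset_iff, Finset.sdiff_singleton_eq_erase] at hv huniq
    exact Finset.card_eq_one.2 ⟨v, Finset.ext fun w => by
      rw [Finset.mem_filter_univ, Finset.mem_singleton]
      exact ⟨huniq w, fun h => h ▸ hv⟩⟩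
  have hvertex : ∀ v : P.Vertex,
      ({i | i ∈ P.tight v ∧ (P.tight v).erase i ⊆ hs.downFacets l v} : Finset (Fin P.m)).card =
        (if (hs.downFacets l v).card = k then 1 else 0) +
          if (hs.downFacets l v).card = n then n else 0 := fun v => by
    have := card_filter_erase_subset (hs.downFacets_subset (l := l) (v := v))
    rw [hs.card_tight v] at this
    rw [← Finset.filter_filter, Finset.filter_univ_mem, this]
    congr 2
    exact propext (by omega)
  have hdouble : ∑ _i : Fin P.m, 1 = ∑ v : P.Vertex,
      ((if (hs.downFacets l v).card = k then 1 else 0) +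
        if (hs.downFacets l v).card = n then n else 0) := by
    rw [← Finset.sum_congr rfl fun i _ => htops i, ← Finset.sum_congr rfl fun v _ => hvertex v]
    exact Finset.sum_card_bipartiteAbove_eq_sum_card_bipartiteBelow _
  rw [Finset.sum_add_distrib, ← Finset.card_filter, ← Finset.sum_filter, Finset.sum_const,
    Finset.sum_const, smul_eq_mul, smul_eq_mul, mul_one, Finset.card_univ, Fintype.card_fin]
    at hdouble
  have hdim := hl.hNumber_dim hs
  rw [IsSimple.hNumber] at hdim ⊢
  rw [hdim, one_mul] at hdouble
  exact hdouble.symm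

theorem IsSimple.sum_hNumber (hs : P.IsSimple) :
    ∑ k ∈ Finset.range (n + 1), hs.hNumber l k = Fintype.card P.Vertex :=
  (Finset.card_eq_sum_card_fiberwise fun v _ => Finset.mem_coe.2 <| Finset.mem_range_succ_iff.2 <|
    (Finset.card_le_card hs.downFacets_subset).trans (hs.card_tight v).le).symm

theorem IsSimple.euler {P : ConvexPolytope 3} (hs : P.IsSimple) :
    Fintype.card P.Vertex + 4 = 2 * P.m := by
  obtain ⟨l, hl⟩ := P.exists_isGeneric
  have hsum := hs.sum_hNumber (l := l)
  simp only [Finset.sum_range_succ, Finset.sum_range_zero, zero_add] at hsum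
  have h₃ := hl.hNumber_dim hs
  have h₀ := hl.hNumber_neg hs (zero_add 3)
  rw [hl.neg.hNumber_dim hs] at h₀
  have h₂ := hl.hNumber_add_dim hs (two_add_one_eq_three)
  have h₁ := hl.neg.hNumber_add_dim hs (two_add_one_eq_three)
  rw [hl.hNumber_neg hs (j := 1) (by norm_num)] at h₁
  omega

end HVector

theorem IsSimple.isEdge_facet_inter_facet {P : ConvexPolytope 3} (hs : P.IsSimple)
    {v : P.Vertex} {i j : Fin P.m} (hij : i ≠ j) (hi : i ∈ P.tight v) (hj : j ∈ P.tight v) :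
    P.IsEdge (P.facet i ∩ P.facet j) := by
  have hpair : ({i, j} : Finset (Fin P.m)) ⊆ P.tight v := by simp [Finset.insert_subset_iff, hi, hj]
  have hcard := Finset.card_sdiff_add_card_eq_card hpair
  rw [hs.card_tight v, Finset.card_pair hij] at hcard
  obtain ⟨c, hc⟩ := Finset.card_eq_one.1 (show (P.tight v \ {i, j}).card = 1 by omega)
  have hcv := (Finset.mem_sdiff.1 (hc ▸ Finset.mem_singleton_self c)).1
  have herase : (P.tight v).erase c = {i, j} := by
    rw [← Finset.sdiff_singleton_eq_erase, ← hc, Finset.sdiff_sdiff_eq_self hpair]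
  have hedge := hs.isEdge_of_mem_tight hcv
  rw [herase] at hedge
  convert hedge using 1
  ext x
  simp only [Set.mem_inter_iff, mem_facet, Finset.coe_pair, Set.mem_iInter, Set.mem_insert_iff,
    Set.mem_singleton_iff, forall_eq_or_imp, forall_eq]
  tauto

end ConvexPolytope

/-- The combinatorics of the boundary of a simple `3`-polytope with set of vertices `V` and set of
facets `Φ`: `N v` is the set of the three facets that meet in the vertex `v`, and the edges at `v`
lead to the vertices `w` for which `N v \ N w` is a singleton. -/
structure CubicSphere (V Φ : Type*) [Fintype V] [Fintype Φ] [DecidableEq Φ] where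
  N : V → Finset Φ
  card_N : ∀ v, (N v).card = 3
  existsUnique_nbr : ∀ v, ∀ a ∈ N v, ∃! w, N v \ N w = {a}
  /-- Faces are connected: two vertices are joined by a path in the smallest face they share. -/
  connected : ∀ v w, Relation.ReflTransGen
    (fun u u' => (∃ a, N u \ N u' = {a}) ∧ N v ∩ N w ⊆ N u') v w
  euler : Fintype.card V + 4 = 2 * Fintype.card Φ

/-- The boundary of a simple `3`-polytope. -/
noncomputable def ConvexPolytope.IsSimple.toCubicSphere {P : ConvexPolytope 3} (hs : P.IsSimple) :
    CubicSphere P.Vertex (Fin P.m) where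
  N v := P.tight v
  card_N := hs.card_tight
  existsUnique_nbr _ _ := hs.existsUnique_nbr
  connected := hs.reflTransGen_nbr
  euler := by simpa only [Fintype.card_fin] using hs.euler

namespace CubicSphere

variable {V Φ : Type*} [Fintype V] [Fintype Φ] [DecidableEq Φ] {S : CubicSphere V Φ}

section Corners

variable (S) in
theorem adj_induction {p : V → Prop} {v w : V} (hv : p v) (hstep : ∀ u u' a,
    S.N u \ S.N u' = {a} → S.N v ∩ S.N w ⊆ S.N u' → p u → p u') : p w := by
  suffices ∀ x, Relation.ReflTransGen
      (fun u u' => (∃ a, S.N u \ S.N u' = {a}) ∧ S.N v ∩ S.N w ⊆ S.N u') v x → p x from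
    this w (S.connected v w)
  intro x hx
  induction hx with
  | refl => exact hv
  | tail _ h ih => exact h.1.elim fun a ha => hstep _ _ a ha h.2 ih

theorem exists_sdiff_eq_singleton_symm {v w : V} {a : Φ} (h : S.N v \ S.N w = {a}) :
    ∃ b, S.N w \ S.N v = {b} := by
  rw [← Finset.card_eq_one, Finset.card_sdiff_comm (by rw [S.card_N, S.card_N]), h,
    Finset.card_singleton]

variable (S) in
theorem N_injective : Function.Injective S.N := by
  intro v v' h
  obtain ⟨a, ha⟩ : (S.N v).Nonempty := Finset.card_pos.1 (by rw [S.card_N]; norm_num)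
  obtain ⟨w, hw, -⟩ := S.existsUnique_nbr v a ha
  obtain ⟨b, hb⟩ := exists_sdiff_eq_singleton_symm hw
  have hbw : b ∈ S.N w := (Finset.mem_sdiff.1 (hb ▸ Finset.mem_singleton_self b)).1
  exact (S.existsUnique_nbr w b hbw).unique hb (h ▸ hb)

variable (S) in
/-- The facets `a`, `b`, `c` meet in a vertex. -/
def Corner (a b c : Φ) : Prop := ∃ v, S.N v = {a, b, c}

variable {a b c d e x y z : Φ} {v w : V}

theorem Corner.rotate (h : S.Corner a b c) : S.Corner b c a := by
  obtain ⟨v, hv⟩ := h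
  exact ⟨v, by rw [hv, Finset.insert_comm, Finset.pair_comm]⟩

theorem Corner.swap_left (h : S.Corner a b c) : S.Corner b a c := by
  obtain ⟨v, hv⟩ := h
  exact ⟨v, by rw [hv, Finset.insert_comm]⟩

theorem Corner.swap_right (h : S.Corner a b c) : S.Corner a c b := by
  obtain ⟨v, hv⟩ := h
  exact ⟨v, by rw [hv, Finset.pair_comm]⟩

theorem Corner.ne (h : S.Corner a b c) : a ≠ b ∧ a ≠ c ∧ b ≠ c := by
  obtain ⟨v, hv⟩ := h
  have hcard := S.card_N v
  rw [hv] at hcard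
  refine ⟨?_, ?_, ?_⟩ <;> rintro rfl <;> grind [Finset.card_le_two]

theorem exists_N_eq_of_mem (h : a ∈ S.N v) : ∃ b c, S.N v = {a, b, c} := by
  have hcard : ((S.N v).erase a).card = 2 := by rw [Finset.card_erase_of_mem h, S.card_N]
  obtain ⟨b, c, -, hbc⟩ := Finset.card_eq_two.1 hcard
  exact ⟨b, c, by rw [← hbc, Finset.insert_erase h]⟩

theorem exists_N_eq_of_mem_of_mem (ha : a ∈ S.N v) (hb : b ∈ S.N v) (hab : a ≠ b) :
    ∃ c, S.N v = {a, b, c} := by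
  obtain ⟨x, y, he⟩ := exists_N_eq_of_mem ha
  rw [he, Finset.mem_insert, Finset.mem_insert, Finset.mem_singleton] at hb
  rcases hb with rfl | rfl | rfl
  · exact absurd rfl hab
  · exact ⟨y, he⟩
  · exact ⟨x, by rw [he, Finset.pair_comm]⟩

theorem Corner.eq_of_ne_of_ne (hc : S.Corner a b c) (hd : S.Corner a b d) (he : S.Corner a b e)
    (hdc : d ≠ c) (hec : e ≠ c) : d = e := by
  have hnbr : ∀ {u v : V} {f : Φ}, S.N u = {a, b, c} → S.N v = {a, b, f} → f ≠ c →
      S.N u \ S.N v = {c} := by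
    intro u v f hu hv hf
    have := hc.ne
    ext t
    simp only [hu, hv, Finset.mem_sdiff, Finset.mem_insert, Finset.mem_singleton]
    grind
  have hdne := hd.ne
  obtain ⟨u, hu⟩ := hc
  obtain ⟨v, hv⟩ := hd
  obtain ⟨w, hw⟩ := he
  obtain rfl : v = w := (S.existsUnique_nbr u c (by simp [hu])).unique (hnbr hu hv hdc)
    (hnbr hu hw hec)
  have : d ∈ S.N v := by simp [hv]
  rw [hw, Finset.mem_insert, Finset.mem_insert, Finset.mem_singleton] at this
  grind

theorem Corner.exists_ne (h : S.Corner a b c) : ∃ d, d ≠ c ∧ S.Corner a b d := by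
  have hne := h.ne
  obtain ⟨v, hv⟩ := h
  obtain ⟨w, hw, -⟩ := S.existsUnique_nbr v c (by simp [hv])
  have hmem : ∀ f, f ∈ S.N v → f ≠ c → f ∈ S.N w := by
    intro f hf hfc
    by_contra hfw
    exact hfc (Finset.mem_singleton.1 (hw ▸ Finset.mem_sdiff.2 ⟨hf, hfw⟩))
  obtain ⟨d, hd⟩ := exists_N_eq_of_mem_of_mem (hmem a (by simp [hv]) hne.2.1)
    (hmem b (by simp [hv]) hne.2.2) hne.1
  have hcw : c ∉ S.N w := (Finset.mem_sdiff.1 (hw ▸ Finset.mem_singleton_self c)).2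
  exact ⟨d, fun hdc => hcw (by simp [hd, hdc]), w, hd⟩

theorem Corner.eq_or_eq_of_eq (h : S.Corner a x y) (he : ({a, x, y} : Finset Φ) = {a, b, c}) :
    (x = b ∧ y = c) ∨ (x = c ∧ y = b) := by
  have hne := h.ne
  have hx : x ∈ ({a, b, c} : Finset Φ) := he ▸ by simp
  have hy : y ∈ ({a, b, c} : Finset Φ) := he ▸ by simp
  simp only [Finset.mem_insert, Finset.mem_singleton] at hx hy
  grind

end Corners

section Walks

variable {a x y z : Φ} {b : ℕ → Φ} {v w : V}

variable (S) in
/-- The number of vertices of the facet `a`. -/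
def deg (a : Φ) : ℕ := (Finset.univ.filter fun v => a ∈ S.N v).card

variable (S) in
/-- The facets `b 0, b 1, …` are met one after another on an endless walk around the facet `a`. -/
def IsWalkAround (a : Φ) (b : ℕ → Φ) : Prop :=
  ∀ i, S.Corner a (b i) (b (i + 1)) ∧ b i ≠ b (i + 2)

theorem Corner.exists_isWalkAround (h : S.Corner a x y) :
    ∃ b, S.IsWalkAround a b ∧ b 0 = x ∧ b 1 = y := by
  have hnext : ∀ p : {p : Φ × Φ // S.Corner a p.1 p.2}, ∃ q : {p : Φ × Φ // S.Corner a p.1 p.2},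
      q.1.1 = p.1.2 ∧ q.1.2 ≠ p.1.1 := by
    rintro ⟨⟨x, y⟩, hxy⟩
    obtain ⟨d, hd, hcorner⟩ := hxy.swap_right.exists_ne
    exact ⟨⟨⟨y, d⟩, hcorner⟩, rfl, hd⟩
  choose f hfst hsnd using hnext
  let s : ℕ → {p : Φ × Φ // S.Corner a p.1 p.2} := fun n => f^[n] ⟨(x, y), h⟩
  have hs : ∀ n, s (n + 1) = f (s n) := fun n => Function.iterate_succ_apply' f n _
  have hs_fst : ∀ n, (s (n + 1)).1.1 = (s n).1.2 := fun n => by rw [hs, hfst]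
  refine ⟨fun n => (s n).1.1, fun i => ?_, rfl, hs_fst 0⟩
  dsimp only
  rw [hs_fst, hs_fst, hs]
  exact ⟨(s i).2, (hsnd _).symm⟩

theorem IsWalkAround.eq_or_eq (hb : S.IsWalkAround a b) {i : ℕ}
    (h : S.Corner a (b (i + 1)) z) : z = b i ∨ z = b (i + 2) :=
  or_iff_not_imp_left.2 fun hz =>
    (hb i).1.swap_right.eq_of_ne_of_ne h (hb (i + 1)).1 hz (hb i).2.symm

theorem IsWalkAround.exists_minimal_gap (hb : S.IsWalkAround a b) :
    ∃ m, 3 ≤ m ∧ (∃ i, b (i + m) = b i) ∧ ∀ n, 0 < n → n < m → ∀ i, b (i + n) ≠ b i := by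
  classical
  have hex : ∃ m, 0 < m ∧ ∃ i, b (i + m) = b i := by
    obtain ⟨i, j, hij, he⟩ := Finite.exists_ne_map_eq_of_infinite b
    rcases lt_or_gt_of_ne hij with h | h
    · exact ⟨j - i, by omega, i, by rw [he]; congr 1; omega⟩
    · exact ⟨i - j, by omega, j, by rw [← he]; congr 1; omega⟩
  obtain ⟨hpos, i, hi⟩ := Nat.find_spec hex
  refine ⟨Nat.find hex, ?_, ⟨i, hi⟩, fun n hn hlt i he => Nat.find_min hex hlt ⟨hn, i, he⟩⟩
  generalize Nat.find hex = m at hpos hi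
  by_contra! hlt
  interval_cases m
  · exact (hb i).1.ne.2.2 hi.symm
  · exact (hb i).2 hi.symm

theorem IsWalkAround.periodic_of_minimal_gap (hb : S.IsWalkAround a b) {m : ℕ} (hm : 3 ≤ m)
    (hex : ∃ i, b (i + m) = b i) (hmin : ∀ n, 0 < n → n < m → ∀ i, b (i + n) ≠ b i) :
    Function.Periodic b m := by
  have forward : ∀ j, b (j + m) = b j → b (j + 1 + m) = b (j + 1) := by
    intro j hj
    have h : S.Corner a (b (j + (m - 1) + 1)) (b (j + 1)) := by
      rw [show j + (m - 1) + 1 = j + m by omega, hj]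
      exact (hb j).1
    rcases hb.eq_or_eq h with h | h
    · exact absurd (by rw [h]; congr 1; omega) (hmin (m - 2) (by omega) (by omega) (j + 1))
    · rw [h]; congr 1; omega
  have backward : ∀ j, b (j + 1 + m) = b (j + 1) → b (j + m) = b j := by
    intro j hj
    have h : S.Corner a (b (j + m + 1)) (b j) := by
      rw [show j + m + 1 = j + 1 + m by omega, hj]
      exact (hb j).1.swap_right
    rcases hb.eq_or_eq h with h | h
    · exact h.symm
    · rw [show j + m + 2 = j + 1 + 1 + m by omega, forward _ hj] at h
      exact absurd h (hb j).2
  obtain ⟨i, hi⟩ := hex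
  have hzero : b (0 + m) = b 0 := by
    induction i with
    | zero => exact hi
    | succ i ih => exact ih (backward i hi)
  intro j
  induction j with
  | zero => exact hzero
  | succ j ih => exact forward j ih

theorem IsWalkAround.exists_forall_modEq (hb : S.IsWalkAround a b) :
    ∃ m, 3 ≤ m ∧ ∀ i j, b i = b j ↔ i ≡ j [MOD m] := by
  obtain ⟨m, hm, hex, hmin⟩ := hb.exists_minimal_gap
  have hper := hb.periodic_of_minimal_gap hm hex hmin
  refine ⟨m, hm, fun i j => ?_⟩
  rw [← hper.map_mod_nat i, ← hper.map_mod_nat j, Nat.ModEq]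
  have hi := Nat.mod_lt i (by omega : 0 < m)
  have hj := Nat.mod_lt j (by omega : 0 < m)
  refine ⟨fun he => ?_, congrArg b⟩
  rcases lt_trichotomy (i % m) (j % m) with h | h | h
  · exact absurd (by rw [he]; congr 1; omega) (hmin (j % m - i % m) (by omega) (by omega) (i % m))
  · exact h
  · exact absurd (by rw [← he]; congr 1; omega) (hmin (i % m - j % m) (by omega) (by omega) (j % m))

theorem IsWalkAround.exists_N_eq_of_mem (hb : S.IsWalkAround a b) (ha : a ∈ S.N v) {j : ℕ}
    (hj : b j ∈ S.N v) : ∃ i, S.N v = {a, b i, b (i + 1)} := by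
  obtain ⟨z, hz⟩ := exists_N_eq_of_mem_of_mem ha hj (hb j).1.ne.1
  obtain ⟨m, hm, hmod⟩ := hb.exists_forall_modEq
  have hprev : b (j + (m - 1) + 1) = b j := (hmod _ _).2 (by
    rw [show j + (m - 1) + 1 = j + m by omega]; exact Nat.add_modEq_right)
  rw [← hprev] at hz
  rcases hb.eq_or_eq ⟨v, hz⟩ with rfl | rfl
  · exact ⟨_, by rw [hz, Finset.pair_comm]⟩
  · exact ⟨_, hz⟩

theorem IsWalkAround.exists_N_eq (hb : S.IsWalkAround a b) (ha : a ∈ S.N w) :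
    ∃ i, S.N w = {a, b i, b (i + 1)} := by
  obtain ⟨v, hv⟩ := (hb 0).1
  refine S.adj_induction (p := fun u => ∃ i, S.N u = {a, b i, b (i + 1)}) (v := v) ⟨0, hv⟩ ?_
  rintro u u' c hc hsub ⟨i, hi⟩
  have ha' : a ∈ S.N u' := hsub (Finset.mem_inter.2 ⟨by simp [hv], ha⟩)
  have hmem : ∀ f, f ∈ S.N u → f ≠ c → f ∈ S.N u' := fun f hf hfc =>
    not_not.1 fun hfu => hfc (Finset.mem_singleton.1 (hc ▸ Finset.mem_sdiff.2 ⟨hf, hfu⟩))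
  by_cases hic : b i = c
  · exact hb.exists_N_eq_of_mem ha' (hmem (b (i + 1)) (by simp [hi])
      fun h => (hb i).1.ne.2.2 (hic.trans h.symm))
  · exact hb.exists_N_eq_of_mem ha' (hmem (b i) (by simp [hi]) hic)

theorem IsWalkAround.deg_eq (hb : S.IsWalkAround a b) {m : ℕ} (hm : 3 ≤ m)
    (hmod : ∀ i j, b i = b j ↔ i ≡ j [MOD m]) : S.deg a = m := by
  classical
  choose f hf using fun i => (hb i).1
  have hf_eq : ∀ i j, f i = f j ↔ i ≡ j [MOD m] := by
    intro i j
    refine ⟨fun he => ?_, fun he => S.N_injective ?_⟩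
    · have hN : ({a, b i, b (i + 1)} : Finset Φ) = {a, b j, b (j + 1)} := by rw [← hf, ← hf, he]
      rcases (hb i).1.eq_or_eq_of_eq hN with ⟨h, -⟩ | ⟨h₁, h₂⟩
      · exact (hmod _ _).1 h
      · have hcycle : i ≡ i + 2 [MOD m] :=
          ((hmod _ _).1 h₁).trans (((hmod _ _).1 h₂).symm.add_right 1)
        exact absurd ((hmod _ _).2 hcycle) (hb i).2
    · rw [hf, hf, (hmod _ _).2 he, (hmod _ _).2 (he.add_right 1)]
  have himage : (Finset.univ.filter fun v => a ∈ S.N v) = (Finset.range m).image f := by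
    ext v
    simp only [Finset.mem_filter, Finset.mem_univ, true_and, Finset.mem_image, Finset.mem_range]
    constructor
    · intro hv
      obtain ⟨i, hi⟩ := hb.exists_N_eq hv
      exact ⟨i % m, Nat.mod_lt _ (by omega),
        ((hf_eq _ _).2 (Nat.mod_modEq i m)).trans (S.N_injective (by rw [hf, hi]))⟩
    · rintro ⟨i, -, rfl⟩
      simp [hf]
  rw [deg, himage, Finset.card_image_of_injOn, Finset.card_range]
  intro i hi j hj hij
  exact ((hf_eq i j).1 hij).eq_of_lt_of_lt (by simpa using hi) (by simpa using hj)

theorem IsWalkAround.eq_iff (hb : S.IsWalkAround a b) {i j : ℕ} :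
    b i = b j ↔ i ≡ j [MOD S.deg a] := by
  obtain ⟨m, hm, hmod⟩ := hb.exists_forall_modEq
  rw [hb.deg_eq hm hmod, hmod]

end Walks

section Arcs

variable {a v x y z : Φ} {l : List Φ}

variable (S) in
/-- The facets of the list are met one after another on a walk around the facet `a`. -/
def IsArc (a : Φ) : List Φ → Prop
  | x :: y :: z :: l => S.Corner a x y ∧ x ≠ z ∧ IsArc a (y :: z :: l)
  | [x, y] => S.Corner a x y
  | _ => True

theorem IsArc.cons (h : S.IsArc a (y :: z :: l)) (hc : S.Corner a x y) (hne : x ≠ z) :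
    S.IsArc a (x :: y :: z :: l) :=
  ⟨hc, hne, h⟩

theorem IsArc.concat (h : S.IsArc a (l ++ [x, y])) (hc : S.Corner a y z) (hne : x ≠ z) :
    S.IsArc a (l ++ [x, y, z]) := by
  induction l with
  | nil => exact ⟨h, hne, hc⟩
  | cons p l ih =>
    match l, h, ih with
    | [], h, ih => exact ⟨h.1, h.2.1, ih h.2.2⟩
    | [_], h, ih => exact ⟨h.1, h.2.1, ih h.2.2⟩
    | _ :: _ :: _, h, ih => exact ⟨h.1, h.2.1, ih h.2.2⟩

theorem IsArc.eq_map_range (h : S.IsArc a (x :: y :: l)) {b : ℕ → Φ} (hb : S.IsWalkAround a b)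
    (hx : b 0 = x) (hy : b 1 = y) : x :: y :: l = (List.range (l.length + 2)).map b := by
  induction l generalizing x y b with
  | nil => simp [List.range_succ, hx, hy]
  | cons z l ih =>
    obtain ⟨-, hne, h⟩ := h
    have hz : b 2 = z := by
      have hcorner : S.Corner a y z := by cases l with
        | nil => exact h
        | cons => exact h.1
      rcases hb.eq_or_eq (i := 0) (hy.symm ▸ hcorner) with hz | hz
      · exact absurd (hx.symm.trans hz.symm) hne
      · exact hz.symm
    rw [List.length_cons, List.range_succ_eq_map, List.map_cons, List.map_map, hx,
      ih h (b := b ∘ Nat.succ) (fun i => hb (i + 1)) hy hz]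

theorem IsArc.exists_eq_map_range (h : S.IsArc a (x :: y :: l)) :
    ∃ b, S.IsWalkAround a b ∧ x :: y :: l = (List.range (l.length + 2)).map b := by
  have hcorner : S.Corner a x y := by cases l with
    | nil => exact h
    | cons => exact h.1
  obtain ⟨b, hb, hx, hy⟩ := hcorner.exists_isWalkAround
  exact ⟨b, hb, h.eq_map_range hb hx hy⟩

theorem IsArc.nodup (h : S.IsArc a (x :: y :: l)) (hl : l.length + 2 ≤ S.deg a) :
    (x :: y :: l).Nodup := by
  obtain ⟨b, hb, he⟩ := h.exists_eq_map_range
  rw [he]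
  refine List.nodup_range.map_on fun i hi j hj hij => ?_
  rw [List.mem_range] at hi hj
  exact (hb.eq_iff.1 hij).eq_of_lt_of_lt (by omega) (by omega)

theorem IsArc.head_eq_getLast (h : S.IsArc a (x :: y :: l)) (hl : l.length + 1 = S.deg a) :
    x = (y :: l).getLast (List.cons_ne_nil y l) := by
  obtain ⟨b, hb, he⟩ := h.exists_eq_map_range
  have hfirst : x = b 0 := by
    rw [List.range_succ_eq_map, List.map_cons] at he
    exact (List.cons.inj he).1
  have hlast : (y :: l).getLast (List.cons_ne_nil y l) = b (l.length + 1) := by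
    simpa [List.getLast?_eq_getLast_of_ne_nil, List.getLast?_map, List.getLast?_range]
      using congrArg List.getLast? he
  rw [hfirst, hlast, hb.eq_iff, hl]
  simp [Nat.ModEq]

end Arcs

end CubicSphere

namespace CubicSphere

variable {V Φ : Type*} [Fintype V] [Fintype Φ] [DecidableEq Φ] {S : CubicSphere V Φ}

variable (S) in
/-- All facets are pentagons and hexagons. -/
def IsFullerene : Prop := ∀ a, S.deg a = 5 ∨ S.deg a = 6

section ShortLoops

variable {a x y z t u v : Φ} {l : List Φ}

theorem IsArc.of_append {l' : List Φ} (h : S.IsArc a (l ++ l')) : S.IsArc a l := by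
  induction l with
  | nil => trivial
  | cons p l ih =>
    match l, h, ih with
    | [], _, _ => trivial
    | [_], h, _ => cases l' with
      | nil => exact h
      | cons => exact h.1
    | _ :: _ :: _, h, ih => exact ⟨h.1, h.2.1, ih h.2.2⟩

theorem IsArc.corner_getLast (h : S.IsArc a (l ++ [x, y])) : S.Corner a x y := by
  induction l with
  | nil => exact h
  | cons p l ih =>
    match l, h, ih with
    | [], h, _ => exact h.2.2
    | [_], h, ih => exact ih h.2.2
    | _ :: _ :: _, h, ih => exact ih h.2.2

theorem IsArc.exists_concat (h : S.IsArc a (l ++ [x, y])) : ∃ z, S.IsArc a (l ++ [x, y, z]) := by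
  obtain ⟨z, hz, hcorner⟩ := h.corner_getLast.swap_right.exists_ne
  exact ⟨z, h.concat hcorner hz.symm⟩

theorem IsArc.corner_of_deg_eq_five (h : S.IsArc a [x, y, z, t, u]) (ha : S.deg a = 5) :
    S.Corner a u x := by
  obtain ⟨v, hv⟩ := h.exists_concat (l := [x, y, z])
  obtain rfl : x = v := hv.head_eq_getLast (by simp [ha])
  exact hv.corner_getLast (l := [x, y, z, t])

theorem IsArc.corner_of_deg_eq_six (h : S.IsArc a [x, y, z, t, u, v]) (ha : S.deg a = 6) :
    S.Corner a v x := by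
  obtain ⟨w, hw⟩ := h.exists_concat (l := [x, y, z, t])
  obtain rfl : x = w := hw.head_eq_getLast (by simp [ha])
  exact hw.corner_getLast (l := [x, y, z, t, u])

namespace IsFullerene

variable (hd : S.IsFullerene)

include hd

theorem nodup_of_isArc (h : S.IsArc a (x :: y :: l)) (hl : l.length ≤ 3) :
    (x :: y :: l).Nodup :=
  h.nodup (by rcases hd a with h | h <;> omega)

theorem not_corner_three (h₀ : S.Corner a x y) (h₁ : S.Corner a y z) : ¬ S.Corner a z x :=
  fun h₂ => by simpa using
    hd.nodup_of_isArc (l := [z, x]) ⟨h₀, h₂.ne.2.2.symm, h₁, h₀.ne.2.2.symm, h₂⟩ (by simp)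

theorem not_corner_four (h : S.IsArc a [x, y, z, t]) : ¬ S.Corner a t x := fun hc => by
  simpa using hd.nodup_of_isArc (h.concat (l := [x, y]) hc h.2.1.symm) (by simp)

theorem eq_or_corner_of_isArc (h : S.IsArc a [x, y, z, t, u, v]) : v = x ∨ S.Corner a v x := by
  rcases hd a with ha | ha
  · exact .inl (h.head_eq_getLast (by simp [ha])).symm
  · exact .inr (h.corner_of_deg_eq_six ha)

theorem corner_or_exists_of_isArc (h : S.IsArc a [x, y, z, t, u]) :
    S.Corner a u x ∨ ∃ v, S.IsArc a [t, u, v, x, y] := by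
  rcases hd a with ha | ha
  · exact .inl (h.corner_of_deg_eq_five ha)
  obtain ⟨v, hv⟩ := h.exists_concat (l := [x, y, z])
  have hnodup : [x, y, z, t, u, v].Nodup := hv.nodup (by simp [ha])
  have htuv : S.IsArc a [t, u, v] := hv.2.2.2.2.2.2
  have hux : u ≠ x := by grind
  have hvy : v ≠ y := by grind
  exact .inr ⟨v, htuv.1, htuv.2.1, htuv.2.2, hux, hv.corner_of_deg_eq_six ha, hvy, h.1⟩

end IsFullerene

end ShortLoops

/-! ### Short loops that cannot occur in a fullerene -/

-- A loop of three or four facets is given with the facets that it meets on one side; the digits in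
-- the names of the lemmas count, for each facet of the loop, its neighbours on that side.

namespace IsFullerene

variable (hd : S.IsFullerene) {A B C D x y z z' t z₀ z₁ z₂ z₃ z₄ v p q : Φ}

include hd

theorem not_loop_233 (hA : S.IsArc A [C, x, y, B]) (hB : S.IsArc B [A, y, z, t, C])
    (hC : S.IsArc C [B, t, z', x, A]) : False := by
  have hABC : ¬ S.Corner A B C := hd.not_corner_four hA
  rcases hd.corner_or_exists_of_isArc hB with h | ⟨v, htC, htv, hCv, -, hvA, -⟩
  · exact hABC h.rotate.rotate
  rcases hd.corner_or_exists_of_isArc hC with h | ⟨v', -, -, hAv', -, hv'B, hv't, -⟩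
  · exact hABC h.rotate
  obtain rfl : v = v' := htC.swap_right.eq_of_ne_of_ne hCv hv'B.rotate.rotate htv.symm hv't
  exact hd.not_corner_three hvA.swap_left.swap_right hCv.rotate.rotate hAv'.rotate.rotate

theorem not_loop_224 (hA : S.IsArc A [C, x, z, z', y, B]) (hB : S.IsArc B [A, y, t, C]) :
    False := by
  rcases hd.eq_or_corner_of_isArc hA with rfl | h
  · exact (hB.corner_getLast (l := [A, y])).ne.2.1 rfl
  · exact hd.not_corner_four hB h.rotate

theorem not_loop_223 (hA : S.IsArc A [C, x, y, B]) (hB : S.IsArc B [A, y, t, C])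
    (hC : S.IsArc C [B, t, z, x, A]) : False := by
  rcases hd.corner_or_exists_of_isArc hC with h | ⟨v, -, hxv, hAv, -, hvB, hvt, -⟩
  · exact hd.not_corner_four hA h.rotate
  obtain ⟨u, hu⟩ := hA.exists_concat (l := [C, x])
  have hBu : S.Corner A B u := hu.corner_getLast (l := [C, x, y])
  have hyu : y ≠ u := hu.2.2.2.2.2.1
  have huv : u ≠ v := by
    rintro rfl
    exact hd.not_corner_three hBu.rotate.rotate hvB.swap_left.swap_right hAv.rotate.rotate
  have hAuv : S.Corner A u v := by
    have harc : S.IsArc A [v, C, x, y, B, u] := hu.cons hAv.rotate hxv.symm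
    exact (hd.eq_or_corner_of_isArc harc).resolve_left huv
  have hBvu : S.Corner B v u := by
    have harc : S.IsArc B ([u, A, y] ++ [t, C, v]) :=
      (hB.cons hBu.rotate hyu.symm).concat (l := [u, A, y]) hvB.rotate.rotate hvt.symm
    exact (hd.eq_or_corner_of_isArc harc).resolve_left huv.symm
  exact hd.not_corner_three hBu.rotate.rotate hBvu.rotate.rotate hAuv.rotate

theorem not_loop_2222 (hA : S.IsArc A [B, v, D]) (hB : S.IsArc B [v, A, z₁, z₂, C, p])
    (hC : S.IsArc C [p, B, z₂, z₃, D, q]) (hD : S.IsArc D [q, C, z₃, z₄, A, v]) : False := by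
  have hBv : S.Corner B v A := hB.1
  have hCp : S.Corner C p B := hC.1
  have hDq : S.Corner D q C := hD.1
  have hvD : S.Corner A v D := hA.2.2
  have hBD : B ≠ D := hA.2.1
  have hAC : A ≠ C := by grind [hd.nodup_of_isArc hB.2.2 (by simp)]
  have hAp : A ≠ p := by grind [hd.nodup_of_isArc hB.2.2 (by simp)]
  have hBq : B ≠ q := by grind [hd.nodup_of_isArc hC.2.2 (by simp)]
  have hCv : C ≠ v := by grind [hd.nodup_of_isArc hD.2.2 (by simp)]
  by_cases hpv : p = v
  · subst hpv
    by_cases hqp : q = p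
    · subst hqp
      have harc : S.IsArc q [A, B, C, D] := ⟨hBv.swap_left.swap_right, hAC, hCp.rotate, hBD,
        hDq.rotate⟩
      exact hd.not_corner_four harc hvD.rotate
    · have hCqp : S.Corner C q p := (hd.eq_or_corner_of_isArc hC).resolve_left hqp
      have hDpq : S.Corner D p q := (hd.eq_or_corner_of_isArc hD).resolve_left (Ne.symm hqp)
      exact hd.not_corner_three hDq.rotate hDpq.rotate.rotate hCqp.rotate
  have hBpv : S.Corner B p v := (hd.eq_or_corner_of_isArc hB).resolve_left hpv
  by_cases hqp : q = p
  · subst hqp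
    have hDvq : S.Corner D v q := (hd.eq_or_corner_of_isArc hD).resolve_left (Ne.symm hpv)
    have harc : S.IsArc q [B, C, D, v] :=
      ⟨hCp.rotate, hBD, hDq.rotate, hCv, hDvq.rotate.rotate⟩
    exact hd.not_corner_four harc hBpv.rotate
  have hCqp : S.Corner C q p := (hd.eq_or_corner_of_isArc hC).resolve_left hqp
  by_cases hvq : v = q
  · subst hvq
    exact hd.not_corner_three hCp.rotate hCqp.rotate.rotate hBpv.rotate
  have hDvq : S.Corner D v q := (hd.eq_or_corner_of_isArc hD).resolve_left hvq
  have hpD : p ≠ D := by grind [hd.nodup_of_isArc (hC.of_append (l := [p, B, z₂, z₃, D])) (by simp)]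
  have hqA : q ≠ A := by grind [hd.nodup_of_isArc (hD.of_append (l := [q, C, z₃, z₄, A])) (by simp)]
  have hp : S.IsArc p [v, B, C, q] := ⟨hBpv.rotate, hCv.symm, hCp.rotate, hBq, hCqp.rotate.rotate⟩
  have hq : S.IsArc q [p, C, D, v] := ⟨hCqp.rotate, hpD, hDq.rotate, hCv, hDvq.rotate.rotate⟩
  have hv : S.IsArc v [q, D, A, B, p] :=
    ⟨hDvq.rotate, hqA, hvD.rotate, hBD.symm, hBv.rotate, hAp, hBpv.rotate.rotate⟩
  exact hd.not_loop_223 hp hq hv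

theorem not_loop_3222 (hA : S.IsArc A [D, z₄, z₀, z₁, B]) (hB : S.IsArc B [A, z₁, z₂, C])
    (hC : S.IsArc C [B, z₂, z₃, D]) (hD : S.IsArc D [C, z₃, z₄, A]) : False := by
  rcases hd.corner_or_exists_of_isArc hA with hABD | ⟨v, -, hz₁v, hBv, hBD, hvD, hvz₄, -⟩
  · have hnodup := hd.nodup_of_isArc hA (by simp)
    exact hd.not_loop_233 hC
      (hD.concat (l := [C, z₃]) hABD.rotate.rotate (by grind))
      (hB.cons hABD.rotate (by grind))
  obtain ⟨p, hp⟩ := hB.exists_concat (l := [A, z₁])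
  obtain ⟨q, hq⟩ := hC.exists_concat (l := [B, z₂])
  have hBp : S.Corner B C p := hp.corner_getLast (l := [A, z₁, z₂])
  have hCq : S.Corner C D q := hq.corner_getLast (l := [B, z₂, z₃])
  have hz₂p : z₂ ≠ p := hp.2.2.2.2.2.1
  have hz₃q : z₃ ≠ q := hq.2.2.2.2.2.1
  exact hd.not_loop_2222 ⟨hBv, hBD, hvD⟩ (hp.cons hBv.rotate hz₁v.symm)
    (hq.cons hBp.rotate hz₂p.symm)
    ((hD.cons hCq.rotate hz₃q.symm).concat (l := [q, C, z₃]) hvD.rotate.rotate hvz₄.symm)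

end IsFullerene

end CubicSphere

/-! ### The loop around a loop of five facets -/

namespace CubicSphere

variable {V Φ : Type*} [Fintype V] [Fintype Φ] [DecidableEq Φ] {S : CubicSphere V Φ}

section Patterns

variable {x y t z z' w w' w'' z₀ z₁ z₂ z₃ z₄ a b c d : Φ}

theorem IsArc.isArc_of_isArc (h : S.IsArc x [z, w', w, y]) (h' : S.IsArc y [x, w, w'', z']) :
    S.IsArc w [w'', y, x, w'] :=
  ⟨h'.2.2.1.rotate, h'.2.1.symm, h'.1.rotate.rotate, h.2.2.2.1.symm, h.2.2.1.rotate.rotate⟩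

theorem IsArc.isArc_of_isArc_of_isArc (h : S.IsArc x [z, w', w, y]) (hy : S.IsArc y [x, w, t])
    (h' : S.IsArc t [y, w, w'', z']) : S.IsArc w [w'', t, y, x, w'] :=
  ⟨h'.2.2.1.rotate, h'.2.1.symm, h'.1.rotate.rotate, hy.2.1.symm, hy.1.rotate.rotate,
    h.2.2.2.1.symm, h.2.2.1.rotate.rotate⟩

namespace IsFullerene

-- The digits in the names are the numbers of vertices of `z₀, …, z₄`.

variable (hd : S.IsFullerene)

include hd

theorem not_collar_66555 (h₀ : S.IsArc z₀ [z₄, b, a, z₁]) (h₁ : S.IsArc z₁ [z₀, a, b, z₂]) :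
    False := by
  simpa using hd.nodup_of_isArc (h₀.isArc_of_isArc h₁) (by simp)

theorem not_collar_65655 (h₀ : S.IsArc z₀ [z₄, b, a, z₁]) (h₁ : S.IsArc z₁ [z₀, a, z₂])
    (h₂ : S.IsArc z₂ [z₁, a, b, z₃]) : False := by
  simpa using hd.nodup_of_isArc (h₀.isArc_of_isArc_of_isArc h₁ h₂) (by simp)

theorem not_collar_66655 (h₀ : S.IsArc z₀ [z₄, c, a, z₁]) (h₁ : S.IsArc z₁ [z₀, a, b, z₂])
    (h₂ : S.IsArc z₂ [z₁, b, c, z₃]) (h₃ : S.IsArc z₃ [z₂, c, z₄])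
    (h₄ : S.IsArc z₄ [z₃, c, z₀]) : False := by
  have hc : S.IsArc c [a, z₀, z₄, z₃, z₂, b] :=
    ⟨h₀.2.2.1.rotate, h₀.2.1.symm, h₀.1.rotate.rotate, h₄.2.1.symm, h₄.1.rotate.rotate,
      h₃.2.1.symm, h₃.1.rotate.rotate, h₂.2.2.2.1.symm, h₂.2.2.1.rotate.rotate⟩
  exact hd.not_loop_224 hc (h₁.isArc_of_isArc h₂)

theorem not_collar_66565 (h₀ : S.IsArc z₀ [z₄, c, a, z₁]) (h₁ : S.IsArc z₁ [z₀, a, b, z₂])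
    (h₂ : S.IsArc z₂ [z₁, b, z₃]) (h₃ : S.IsArc z₃ [z₂, b, c, z₄])
    (h₄ : S.IsArc z₄ [z₃, c, z₀]) : False :=
  hd.not_loop_233 (h₀.isArc_of_isArc h₁) (h₃.isArc_of_isArc_of_isArc h₄ h₀)
    (h₁.isArc_of_isArc_of_isArc h₂ h₃)

theorem not_collar_66665 (h₀ : S.IsArc z₀ [z₄, d, a, z₁]) (h₁ : S.IsArc z₁ [z₀, a, b, z₂])
    (h₂ : S.IsArc z₂ [z₁, b, c, z₃]) (h₃ : S.IsArc z₃ [z₂, c, d, z₄])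
    (h₄ : S.IsArc z₄ [z₃, d, z₀]) : False :=
  hd.not_loop_3222 (h₃.isArc_of_isArc_of_isArc h₄ h₀) (h₂.isArc_of_isArc h₃)
    (h₁.isArc_of_isArc h₂) (h₀.isArc_of_isArc h₁)

end IsFullerene

end Patterns

section Collar

variable {z w : ZMod 5 → Φ}

variable (S) in
/-- The facets `w i` surround a loop of five pentagons and hexagons `z i`; the pentagon `z (i + 1)`
meets only one of them, which is counted twice, as `w i` and as `w (i + 1)`. -/
def Collar (z w : ZMod 5 → Φ) : Prop := ∀ i,
  (S.deg (z (i + 1)) = 6 ∧ S.IsArc (z (i + 1)) [z i, w i, w (i + 1), z (i + 2)]) ∨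
  (S.deg (z (i + 1)) = 5 ∧ w i = w (i + 1) ∧ S.IsArc (z (i + 1)) [z i, w i, z (i + 2)])

namespace Collar

theorem shift (h : S.Collar z w) (s : ZMod 5) :
    S.Collar (fun i => z (s + i)) (fun i => w (s + i)) := fun i => by
  simpa only [add_assoc] using h (s + i)

theorem deg_eq (h : S.Collar z w) (i : ZMod 5) : S.deg (z i) = 5 ∨ S.deg (z i) = 6 := by
  have hi := h (i - 1)
  rw [sub_add_cancel] at hi
  exact hi.elim (fun h => .inr h.1) (fun h => .inl h.1)

theorem isArc_of_deg_eq_six (h : S.Collar z w) {i : ZMod 5} (hi : S.deg (z (i + 1)) = 6) :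
    S.IsArc (z (i + 1)) [z i, w i, w (i + 1), z (i + 2)] :=
  (h i).elim (fun h => h.2) fun h => absurd (hi.symm.trans h.1) (by norm_num)

theorem eq_and_isArc_of_deg_eq_five (h : S.Collar z w) {i : ZMod 5}
    (hi : S.deg (z (i + 1)) = 5) : w i = w (i + 1) ∧ S.IsArc (z (i + 1)) [z i, w i, z (i + 2)] :=
  (h i).elim (fun h => absurd (hi.symm.trans h.1) (by norm_num)) fun h => h.2

end Collar

/-- The nonconstant binary necklaces of length five, one representative of each; `true` stands for
a hexagon and `false` for a pentagon of a loop. -/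
def mixedNecklaces : List (Bool × Bool × Bool × Bool × Bool) :=
  [(true, false, false, false, false), (true, true, false, false, false),
    (true, false, true, false, false), (true, true, true, false, false),
    (true, true, false, true, false), (true, true, true, true, false)]

theorem forall_or_exists_shift_mem_mixedNecklaces (p : ZMod 5 → Bool) :
    (∀ i, p i = true) ∨ (∀ i, p i = false) ∨
      ∃ s, (p s, p (s + 1), p (s + 2), p (s + 3), p (s + 4)) ∈ mixedNecklaces := by
  suffices ∀ p : Fin 5 → Bool, (∀ i, p i = true) ∨ (∀ i, p i = false) ∨
    ∃ s, (p s, p (s + 1), p (s + 2), p (s + 3), p (s + 4)) ∈ mixedNecklaces from this p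
  decide

theorem IsFullerene.notMem_mixedNecklaces (hd : S.IsFullerene) (h : S.Collar z w)
    {p : ZMod 5 → Bool} (hp : ∀ i, p i = decide (S.deg (z i) = 6)) :
    (p 0, p 1, p 2, p 3, p 4) ∉ mixedNecklaces := by
  have hexagon (i : ZMod 5) (hi : p (i + 1) = true) :
      S.IsArc (z (i + 1)) [z i, w i, w (i + 1), z (i + 2)] :=
    h.isArc_of_deg_eq_six (of_decide_eq_true ((hp _).symm.trans hi))
  have pentagon (i : ZMod 5) (hi : p (i + 1) = false) :
      w i = w (i + 1) ∧ S.IsArc (z (i + 1)) [z i, w i, z (i + 2)] :=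
    h.eq_and_isArc_of_deg_eq_five
      ((h.deg_eq _).resolve_right (of_decide_eq_false ((hp _).symm.trans hi)))
  have hexagon₀ : p 0 = true → S.IsArc (z 0) [z 4, w 4, w 0, z 1] := hexagon 4
  have hexagon₁ : p 1 = true → S.IsArc (z 1) [z 0, w 0, w 1, z 2] := hexagon 0
  have hexagon₂ : p 2 = true → S.IsArc (z 2) [z 1, w 1, w 2, z 3] := hexagon 1
  have hexagon₃ : p 3 = true → S.IsArc (z 3) [z 2, w 2, w 3, z 4] := hexagon 2
  have pentagon₁ : p 1 = false → w 0 = w 1 ∧ S.IsArc (z 1) [z 0, w 0, z 2] := pentagon 0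
  have pentagon₂ : p 2 = false → w 1 = w 2 ∧ S.IsArc (z 2) [z 1, w 1, z 3] := pentagon 1
  have pentagon₃ : p 3 = false → w 2 = w 3 ∧ S.IsArc (z 3) [z 2, w 2, z 4] := pentagon 2
  have pentagon₄ : p 4 = false → w 3 = w 4 ∧ S.IsArc (z 4) [z 3, w 3, z 0] := pentagon 3
  simp only [mixedNecklaces, List.mem_cons, Prod.mk.injEq, List.not_mem_nil, or_false]
  rintro (⟨h₀, h₁, h₂, h₃, h₄⟩ | ⟨h₀, h₁, h₂, h₃, h₄⟩ | ⟨h₀, h₁, h₂, h₃, h₄⟩ |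
    ⟨h₀, h₁, h₂, h₃, h₄⟩ | ⟨h₀, h₁, h₂, h₃, h₄⟩ | ⟨h₀, h₁, h₂, h₃, h₄⟩)
  · have hw : w 4 = w 0 := by
      rw [(pentagon₁ h₁).1, (pentagon₂ h₂).1, (pentagon₃ h₃).1, (pentagon₄ h₄).1]
    exact (hexagon₀ h₀).2.2.1.ne.2.2 hw
  · have hw : w 4 = w 1 := by rw [(pentagon₂ h₂).1, (pentagon₃ h₃).1, (pentagon₄ h₄).1]
    exact hd.not_collar_66555 (hw ▸ hexagon₀ h₀) (hexagon₁ h₁)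
  · have hw : w 4 = w 2 := by rw [(pentagon₃ h₃).1, (pentagon₄ h₄).1]
    obtain ⟨hw₁, harc₁⟩ := pentagon₁ h₁
    exact hd.not_collar_65655 (hw ▸ hexagon₀ h₀) harc₁ (hw₁ ▸ hexagon₂ h₂)
  · obtain ⟨hw₃, harc₃⟩ := pentagon₃ h₃
    obtain ⟨hw₄, harc₄⟩ := pentagon₄ h₄
    rw [← hw₃] at hw₄ harc₄
    exact hd.not_collar_66655 (hw₄ ▸ hexagon₀ h₀) (hexagon₁ h₁) (hexagon₂ h₂) harc₃ harc₄
  · obtain ⟨hw₂, harc₂⟩ := pentagon₂ h₂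
    obtain ⟨hw₄, harc₄⟩ := pentagon₄ h₄
    exact hd.not_collar_66565 (hw₄ ▸ hexagon₀ h₀) (hexagon₁ h₁) harc₂ (hw₂ ▸ hexagon₃ h₃) harc₄
  · obtain ⟨hw₄, harc₄⟩ := pentagon₄ h₄
    exact hd.not_collar_66665 (hw₄ ▸ hexagon₀ h₀) (hexagon₁ h₁) (hexagon₂ h₂) (hexagon₃ h₃)
      harc₄

theorem IsFullerene.deg_eq_five_or_deg_eq_six_of_collar (hd : S.IsFullerene)
    (h : S.Collar z w) : (∀ i, S.deg (z i) = 5) ∨ ∀ i, S.deg (z i) = 6 := by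
  rcases forall_or_exists_shift_mem_mixedNecklaces fun i => decide (S.deg (z i) = 6) with
    h6 | h5 | ⟨s, hs⟩
  · exact .inr fun i => of_decide_eq_true (h6 i)
  · exact .inl fun i => (h.deg_eq i).resolve_right (of_decide_eq_false (h5 i))
  · exact absurd (by simpa only [add_zero] using hs)
      (hd.notMem_mixedNecklaces (h.shift s) fun _ => rfl)

end Collar

end CubicSphere

/-! ### Rings of five facets -/

namespace CubicSphere

variable {V Φ : Type*} [Fintype V] [Fintype Φ] [DecidableEq Φ] {S : CubicSphere V Φ}

section RingPairs

variable {x x' y w q : ZMod 5 → Φ} {b c : Φ}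

variable (S) in
/-- The facets `y i` form a loop that surrounds the loop of the facets `x i` along a zigzag
cycle. -/
def RingPair (x y : ZMod 5 → Φ) : Prop :=
  ∀ i, S.IsArc (x (i + 1)) [x i, y i, y (i + 1), x (i + 2)]

variable (S) in
/-- The facets `q i` surround the facet `c`. -/
def IsRingAround (c : Φ) (q : ZMod 5 → Φ) : Prop :=
  ∀ i, S.IsArc c [q i, q (i + 1), q (i + 2)]

theorem RingPair.isArc (h : S.RingPair x y) (i : ZMod 5) :
    S.IsArc (y (i + 1)) [y (i + 2), x (i + 2), x (i + 1), y i] := by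
  have hnext := h (i + 1)
  simp only [add_assoc, one_add_one_eq_two] at hnext
  exact (h i).isArc_of_isArc hnext

theorem RingPair.exists_collar (hd : S.IsFullerene) (h : S.RingPair x y) :
    ∃ w, S.Collar y w ∧ ∀ i, w i ≠ x (i + 1) := by
  have hw (i : ZMod 5) : ∃ d, d ≠ x (i + 1) ∧ S.Corner (y i) (y (i + 1)) d :=
    (h i).2.2.1.rotate.exists_ne
  choose w hwx hw using hw
  refine ⟨w, fun i => ?_, hwx⟩
  have hx := hwx (i + 1)
  have hcorner := hw (i + 1)
  simp only [add_assoc, one_add_one_eq_two] at hx hcorner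
  have harc := (h.isArc i).cons hcorner.swap_right hx
  have hfull : S.IsArc (y (i + 1)) [w (i + 1), y (i + 2), x (i + 2), x (i + 1), y i, w i] :=
    harc.concat (l := [w (i + 1), y (i + 2), x (i + 2)]) (hw i).swap_left (hwx i).symm
  have hyw : y i ≠ w (i + 1) := by grind [hd.nodup_of_isArc harc (by simp)]
  have hwy : w i ≠ y (i + 2) := by grind [hd.nodup_of_isArc hfull.2.2 (by simp)]
  have hyy : y i ≠ y (i + 2) := by grind [hd.nodup_of_isArc (h.isArc i) (by simp)]
  rcases hd (y (i + 1)) with h5 | h6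
  · have heq : w (i + 1) = w i := hfull.head_eq_getLast (by simp [h5])
    exact .inr ⟨h5, heq.symm, (hw i).swap_left, hyy, heq ▸ hcorner.swap_right⟩
  · exact .inl ⟨h6, (hw i).swap_left, hyw, hfull.corner_of_deg_eq_six h6, hwy,
      hcorner.swap_right⟩

theorem Collar.ringPair (h : S.Collar y w) (hy : ∀ i, S.deg (y i) = 6) : S.RingPair y w :=
  fun i => h.isArc_of_deg_eq_six (hy (i + 1))

theorem Collar.exists_isRingAround (h : S.Collar y w) (hy : ∀ i, S.deg (y i) = 5) :
    ∃ b, (∀ i, w i = b) ∧ S.IsRingAround b y := by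
  have hw (i : ZMod 5) : w i = w 0 := by
    have hstep (j : ℕ) : w (j : ZMod 5) = w 0 := by
      induction j with
      | zero => simp
      | succ j ih => rw [Nat.cast_succ, ← (h.eq_and_isArc_of_deg_eq_five (hy _)).1, ih]
    rw [← ZMod.natCast_zmod_val i, hstep]
  refine ⟨w 0, hw, fun i => ?_⟩
  obtain ⟨hleft, hne, hright⟩ := (h.eq_and_isArc_of_deg_eq_five (hy (i + 1))).2
  rw [hw] at hleft hright
  exact ⟨hleft.rotate.rotate.swap_right, hne, hright.swap_left⟩

theorem IsRingAround.exists_ringPair (hd : S.IsFullerene) (h : S.IsRingAround c q)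
    (hq : ∀ i, S.deg (q i) = 5) : ∃ y, S.RingPair q y ∧ ∀ i, y i ≠ c := by
  have hy (i : ZMod 5) : ∃ d, d ≠ c ∧ S.Corner (q i) (q (i + 1)) d := (h i).1.rotate.exists_ne
  choose y hyc hy using hy
  refine ⟨y, fun i => ?_, hyc⟩
  have hcorner := hy (i + 1)
  have hright := (h i).2.2
  simp only [add_assoc, one_add_one_eq_two] at hcorner
  have harc : S.IsArc (q (i + 1)) [y i, q i, c, q (i + 2), y (i + 1)] :=
    ⟨(hy i).rotate, hyc i, (h i).1.rotate.swap_left, (h i).2.1, hright.swap_left,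
      (hyc _).symm, hcorner⟩
  have hnodup := hd.nodup_of_isArc harc (by simp)
  exact ⟨(hy i).swap_left, by grind, (harc.corner_of_deg_eq_five (hq _)).swap_right, by grind,
    hcorner.swap_right⟩

theorem RingPair.eq_of_ringPair (h : S.RingPair x y) (h' : S.RingPair x' y)
    (hw : ∀ i, S.Corner (y i) (y (i + 1)) (w i)) (hx : ∀ i, w i ≠ x (i + 1))
    (hx' : ∀ i, w i ≠ x' (i + 1)) : x = x' := by
  have hshift (i : ZMod 5) : x (i + 1) = x' (i + 1) :=
    (hw i).eq_of_ne_of_ne (h i).2.2.1.rotate (h' i).2.2.1.rotate (hx i).symm (hx' i).symm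
  funext i
  simpa only [sub_add_cancel] using hshift (i - 1)

end RingPairs

section RingChains

variable {x y w : ZMod 5 → Φ} {n : ℕ} {R : ℕ → ZMod 5 → Φ}

variable (S) in
/-- The loops `R 0, …, R (n + 1)` successively surround one another, and those in between consist
of hexagons. -/
structure RingChain (n : ℕ) (R : ℕ → ZMod 5 → Φ) : Prop where
  ringPair : ∀ j ≤ n, S.RingPair (R j) (R (j + 1))
  ne : ∀ j < n, ∀ i, R (j + 2) i ≠ R j (i + 1)
  deg_eq_six : ∀ j < n, ∀ i, S.deg (R (j + 1) i) = 6

namespace RingChain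

theorem eq_add_of_succ_eq_add {d j : ℕ} (h : S.RingChain n R) (hj : j + 1 + d ≤ n)
    (h₁ : R (j + 1) = R (j + 1 + d)) (h₂ : R (j + 2) = R (j + 2 + d)) : R j = R (j + d) := by
  rw [Nat.add_right_comm] at h₁ h₂
  have hne := h.ne (j + d) (by omega)
  rw [← h₂] at hne
  exact (h.ringPair j (by omega)).eq_of_ringPair (h₁ ▸ h.ringPair (j + d) (by omega))
    (fun i => (h.ringPair (j + 1) (by omega) i).1.swap_left) (h.ne j (by omega)) hne

theorem eq_zero_of_eq {d j : ℕ} (h : S.RingChain n R) (hj : j + d ≤ n) (h₀ : R j = R (j + d))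
    (h₁ : R (j + 1) = R (j + 1 + d)) : R 0 = R d := by
  induction j with
  | zero => simpa using h₀
  | succ j ih => exact ih (by omega) (h.eq_add_of_succ_eq_add hj h₀ h₁) h₀

theorem lt_card (h : S.RingChain n R) (h₀ : ∀ i, S.deg (R 0 i) = 5) :
    n < Fintype.card ((ZMod 5 → Φ) × (ZMod 5 → Φ)) := by
  by_contra! hn
  obtain ⟨j, j', hne, heq⟩ := Fintype.exists_ne_map_eq_of_card_lt
    (fun j : Fin (n + 1) => (R j, R (j + 1))) (by simpa using Nat.lt_succ_of_le hn)
  wlog hlt : (j : ℕ) < j' generalizing j j'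
  · exact this j' j hne.symm heq.symm (by omega)
  obtain ⟨d, hd⟩ := Nat.exists_eq_add_of_lt hlt
  obtain ⟨heq₀, heq₁⟩ := Prod.mk.inj heq
  have hperiod : R 0 = R (d + 1) := h.eq_zero_of_eq (j := j) (by omega)
    (heq₀.trans (by rw [hd, add_assoc])) (heq₁.trans (by rw [hd]; congr 1; omega))
  have h5 := h₀ 0
  rw [hperiod, h.deg_eq_six d (by omega)] at h5
  norm_num at h5

theorem extend (h : S.RingChain n R) (hw : S.RingPair (R (n + 1)) w)
    (hne : ∀ i, w i ≠ R n (i + 1)) (h6 : ∀ i, S.deg (R (n + 1) i) = 6) :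
    S.RingChain (n + 1) (Function.update R (n + 2) w) := by
  have hold (j : ℕ) (hj : j ≤ n + 1) : Function.update R (n + 2) w j = R j :=
    Function.update_of_ne (by omega) _ _
  refine ⟨fun j hj => ?_, fun j hj => ?_, fun j hj => ?_⟩
  · rw [hold j hj]
    rcases hj.lt_or_eq with hlt | rfl
    · rw [hold (j + 1) (by omega)]
      exact h.ringPair j (by omega)
    · rwa [Function.update_self]
  · rw [hold j (by omega)]
    rcases (Nat.le_of_lt_succ hj).lt_or_eq with hlt | rfl
    · rw [hold (j + 2) (by omega)]
      exact h.ne j hlt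
    · rwa [Function.update_self]
  · rw [hold (j + 1) (by omega)]
    rcases (Nat.le_of_lt_succ hj).lt_or_eq with hlt | rfl
    · exact h.deg_eq_six j hlt
    · exact h6

end RingChain

variable (S) in
/-- The facet `c`, the loops `R 0, …, R (k + 1)` of five facets and the facet `b` successively
surround one another; `c` and the facets of `R 0` are pentagons, those of `R 1, …, R k` are
hexagons. -/
structure CappedRingChain (k : ℕ) (c b : Φ) (R : ℕ → ZMod 5 → Φ) : Prop
    extends S.RingChain k R where
  deg_top : S.deg c = 5
  deg_first : ∀ i, S.deg (R 0 i) = 5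
  top : S.IsRingAround c (R 0)
  ne_top : ∀ i, R 1 i ≠ c
  bottom : S.IsRingAround b (R (k + 1))
  ne_bottom : ∀ i, R k i ≠ b

theorem IsRingAround.exists_cappedRingChain_or_ringChain {c : Φ} {q : ZMod 5 → Φ}
    (hd : S.IsFullerene) (hc : S.deg c = 5) (h : S.IsRingAround c q) (hq : ∀ i, S.deg (q i) = 5)
    (n : ℕ) : (∃ k b R, S.CappedRingChain k c b R) ∨
      ∃ R, S.RingChain n R ∧ R 0 = q ∧ ∀ i, R 1 i ≠ c := by
  induction n with
  | zero =>
    obtain ⟨y, hy, hyc⟩ := h.exists_ringPair hd hq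
    refine .inr ⟨fun j => if j = 0 then q else y, ⟨fun j hj => ?_, by simp, by simp⟩, rfl, hyc⟩
    obtain rfl : j = 0 := by omega
    exact hy
  | succ n ih =>
    rcases ih with hcapped | ⟨R, hR, rfl, hRc⟩
    · exact .inl hcapped
    obtain ⟨w, hw, hne⟩ := (hR.ringPair n le_rfl).exists_collar hd
    rcases hd.deg_eq_five_or_deg_eq_six_of_collar hw with h5 | h6
    · obtain ⟨b, hwb, hb⟩ := hw.exists_isRingAround h5
      refine .inl ⟨n, b, R, hR, hc, hq, h, hRc, hb, fun i hi => hne (i - 1) ?_⟩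
      rw [sub_add_cancel, hwb, hi]
    · have hold (j : ℕ) (hj : j ≤ 1) : Function.update R (n + 2) w j = R j :=
        Function.update_of_ne (by omega) _ _
      refine .inr ⟨_, hR.extend (hw.ringPair h6) hne h6, hold 0 zero_le_one, ?_⟩
      rwa [hold 1 le_rfl]

theorem IsRingAround.exists_cappedRingChain {c : Φ} {q : ZMod 5 → Φ} (hd : S.IsFullerene)
    (hc : S.deg c = 5) (h : S.IsRingAround c q) (hq : ∀ i, S.deg (q i) = 5) :
    ∃ k b R, S.CappedRingChain k c b R := by
  refine (h.exists_cappedRingChain_or_ringChain hd hc hq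
    (Fintype.card ((ZMod 5 → Φ) × (ZMod 5 → Φ)))).resolve_right ?_
  rintro ⟨R, hR, rfl, -⟩
  exact (hR.lt_card hq).false

end RingChains

theorem exists_isRingAround {c : Φ} (hc : S.deg c = 5) : ∃ q : ZMod 5 → Φ, S.IsRingAround c q ∧
    ∀ v a, c ∈ S.N v → a ∈ S.N v → a ≠ c → a ∈ Set.range q := by
  obtain ⟨v, hv⟩ : (Finset.univ.filter fun v => c ∈ S.N v).Nonempty :=
    Finset.card_pos.1 (hc.symm ▸ by norm_num : 0 < S.deg c)
  obtain ⟨x, y, hxy⟩ := exists_N_eq_of_mem (Finset.mem_filter.1 hv).2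
  obtain ⟨b, hb, -, -⟩ := Corner.exists_isWalkAround (S := S) ⟨v, hxy⟩
  have hmod (i : ZMod 5) (j : ℕ) : b (i + j).val = b (i.val + j) := by
    rw [hb.eq_iff, hc, ← ZMod.natCast_eq_natCast_iff]
    simp
  have h₁ (i : ZMod 5) : b (i + 1).val = b (i.val + 1) := by simpa using hmod i 1
  have h₂ (i : ZMod 5) : b (i + 2).val = b (i.val + 2) := by simpa using hmod i 2
  refine ⟨fun i => b i.val, fun i => ?_, fun w a hcw haw hac => ?_⟩
  · dsimp only
    rw [h₁, h₂]
    exact ⟨(hb i.val).1, (hb i.val).2, (hb (i.val + 1)).1⟩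
  · have hrange (j : ℕ) : b j ∈ Set.range fun i : ZMod 5 => b i.val :=
      ⟨j, by simpa using hmod 0 j⟩
    obtain ⟨i, hi⟩ := hb.exists_N_eq hcw
    simp only [hi, Finset.mem_insert, Finset.mem_singleton, hac, false_or] at haw
    rcases haw with rfl | rfl <;> exact hrange _

end CubicSphere

/-! ### Coverings -/

namespace CubicSphere

variable {V Φ : Type*} [Fintype V] [Fintype Φ] [DecidableEq Φ] {S : CubicSphere V Φ}

variable (S) in
/-- A covering of the sphere `S` by a cubic map with vertices `U` and facets `Ψ`: `fct u` lists the
facets at `u`; the edge that leaves `fct u t` leads to `(nbr u t).1`, whose facet number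
`(nbr u t).2` does not contain that edge. -/
structure IsCovering {U Ψ : Type*} (fct : U → Fin 3 → Ψ) (nbr : U → Fin 3 → U × Fin 3) (g : Ψ → Φ)
    (h : U → V) : Prop where
  map_N : ∀ u, S.N (h u) = Finset.univ.image fun t => g (fct u t)
  nbr_nbr : ∀ u t, nbr (nbr u t).1 (nbr u t).2 = (u, t)
  exists_fct_nbr_eq : ∀ u {s t}, s ≠ t →
    ∃ s', s' ≠ (nbr u t).2 ∧ fct (nbr u t).1 s' = fct u s
  ne : ∀ u t, g (fct u t) ≠ g (fct (nbr u t).1 (nbr u t).2)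

namespace IsCovering

variable {U Ψ : Type*} {fct : U → Fin 3 → Ψ} {nbr : U → Fin 3 → U × Fin 3} {g : Ψ → Φ} {h : U → V}
  {a : Φ} {u : U} {t : Fin 3} {v w : V}

theorem mem (H : S.IsCovering fct nbr g h) (u : U) (t : Fin 3) : g (fct u t) ∈ S.N (h u) := by
  rw [H.map_N]
  exact Finset.mem_image_of_mem _ (Finset.mem_univ t)

theorem exists_of_mem (H : S.IsCovering fct nbr g h) (ha : a ∈ S.N (h u)) :
    ∃ t, g (fct u t) = a := by
  rw [H.map_N] at ha
  simpa using ha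

theorem injective_fct (H : S.IsCovering fct nbr g h) (u : U) :
    Function.Injective fun t => g (fct u t) := by
  have hcard := S.card_N (h u)
  rw [H.map_N] at hcard
  have hinj := Finset.injOn_of_card_image_eq (hcard.trans (Finset.card_fin 3).symm)
  rwa [Finset.coe_univ, Set.injOn_univ] at hinj

theorem sdiff_nbr (H : S.IsCovering fct nbr g h) (u : U) (t : Fin 3) :
    S.N (h u) \ S.N (h (nbr u t).1) = {g (fct u t)} := by
  ext a
  rw [Finset.mem_sdiff, Finset.mem_singleton]
  constructor
  · rintro ⟨ha, ha'⟩
    obtain ⟨s, rfl⟩ := H.exists_of_mem ha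
    by_contra hne
    obtain ⟨s', -, hs'⟩ := H.exists_fct_nbr_eq u (s := s) (t := t) (by rintro rfl; exact hne rfl)
    exact ha' (hs' ▸ H.mem _ s')
  · rintro rfl
    refine ⟨H.mem u t, fun ht => ?_⟩
    obtain ⟨r, hr⟩ := H.exists_of_mem ht
    obtain ⟨s, hs, hsr⟩ := H.exists_fct_nbr_eq (nbr u t).1 (s := r) (t := (nbr u t).2)
      (by rintro rfl; exact H.ne u t hr.symm)
    rw [H.nbr_nbr] at hs hsr
    exact hs (H.injective_fct u (by simp only [hsr, hr]))

theorem map_nbr_eq (H : S.IsCovering fct nbr g h) (hv : S.N (h u) \ S.N v = {g (fct u t)}) :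
    h (nbr u t).1 = v :=
  (S.existsUnique_nbr (h u) _ (H.mem u t)).unique (H.sdiff_nbr u t) hv

theorem surjective [Nonempty U] (H : S.IsCovering fct nbr g h) : Function.Surjective h := by
  intro w
  obtain ⟨u₀⟩ := ‹Nonempty U›
  refine S.adj_induction (p := fun v => ∃ u, h u = v) (v := h u₀) ⟨u₀, rfl⟩ ?_
  rintro _ v a ha - ⟨u, rfl⟩
  obtain ⟨t, rfl⟩ := H.exists_of_mem (Finset.mem_sdiff.1 (ha ▸ Finset.mem_singleton_self a)).1
  exact ⟨_, H.map_nbr_eq ha⟩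

theorem subsingleton_fibre_of_sdiff_eq (H : S.IsCovering fct nbr g h)
    (hvw : S.N v \ S.N w = {a}) (hv : (h ⁻¹' {v}).Subsingleton) :
    (h ⁻¹' {w}).Subsingleton := by
  obtain ⟨b, hwv⟩ := exists_sdiff_eq_singleton_symm hvw
  have hb : b ∈ S.N w := (Finset.mem_sdiff.1 (hwv ▸ Finset.mem_singleton_self b)).1
  have hlift (u : U) (hu : h u = w) : ∃ t, h (nbr u t).1 = v ∧
      g (fct (nbr u t).1 (nbr u t).2) = a := by
    subst hu
    obtain ⟨t, rfl⟩ := H.exists_of_mem hb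
    have hnbr : h (nbr u t).1 = v := H.map_nbr_eq hwv
    have hback := H.sdiff_nbr (nbr u t).1 (nbr u t).2
    rw [H.nbr_nbr, hnbr, hvw, Finset.singleton_inj] at hback
    exact ⟨t, hnbr, hback.symm⟩
  intro u hu u' hu'
  obtain ⟨t, ht, hat⟩ := hlift u hu
  obtain ⟨t', ht', hat'⟩ := hlift u' hu'
  have hfst : (nbr u t).1 = (nbr u' t').1 := hv ht ht'
  have hsnd : (nbr u t).2 = (nbr u' t').2 :=
    H.injective_fct (nbr u t).1 (hat.trans (hfst ▸ hat'.symm))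
  have hnbr := H.nbr_nbr u t
  rw [hfst, hsnd, H.nbr_nbr] at hnbr
  exact (congrArg Prod.fst hnbr).symm

theorem injective (H : S.IsCovering fct nbr g h) (hv : (h ⁻¹' {v}).Subsingleton) :
    Function.Injective h := by
  suffices ∀ w, (h ⁻¹' {w}).Subsingleton from fun u u' he => this (h u') he rfl
  exact fun w => S.adj_induction (p := fun w => (h ⁻¹' {w}).Subsingleton) hv
    fun _ _ _ ha _ ih => H.subsingleton_fibre_of_sdiff_eq ha ih

theorem mem_iff (H : S.IsCovering fct nbr g h) (hinj : Function.Injective h) {A : Ψ}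
    (hA : ∃ u t, fct u t = A) : g A ∈ S.N (h u) ↔ ∃ t, fct u t = A := by
  refine ⟨fun hu => ?_, ?_⟩
  · obtain ⟨u₀, t₀, h₀⟩ := hA
    have hA₀ : g A ∈ S.N (h u₀) := h₀ ▸ H.mem u₀ t₀
    suffices ∃ u', h u' = h u ∧ ∃ t, fct u' t = A by
      obtain ⟨u', hu', ht⟩ := this
      rwa [hinj hu'] at ht
    refine S.adj_induction (p := fun v => ∃ u', h u' = v ∧ ∃ t, fct u' t = A) (v := h u₀)
      ⟨u₀, rfl, t₀, h₀⟩ ?_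
    rintro _ x a ha hsub ⟨u', rfl, t, rfl⟩
    have ha' := Finset.mem_sdiff.1 (ha ▸ Finset.mem_singleton_self a)
    obtain ⟨s, rfl⟩ := H.exists_of_mem ha'.1
    have hts : t ≠ s := by
      rintro rfl
      exact ha'.2 (hsub (Finset.mem_inter.2 ⟨hA₀, hu⟩))
    obtain ⟨r, -, hr⟩ := H.exists_fct_nbr_eq u' hts
    exact ⟨_, H.map_nbr_eq ha, r, hr⟩
  · rintro ⟨t, rfl⟩
    exact H.mem u t

end IsCovering

theorem sum_deg : ∑ a, S.deg a = 3 * Fintype.card V := by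
  have hcount := Finset.sum_card_bipartiteAbove_eq_sum_card_bipartiteBelow
    (s := (Finset.univ : Finset Φ)) (t := (Finset.univ : Finset V)) fun a v => a ∈ S.N v
  simpa [Finset.bipartiteAbove, Finset.bipartiteBelow, deg, S.card_N, mul_comm] using hcount

theorem IsFullerene.card_pentagons (hd : S.IsFullerene) :
    (Finset.univ.filter fun a => S.deg a = 5).card = 12 := by
  have hdeg (a : Φ) : S.deg a + (if S.deg a = 5 then 1 else 0) = 6 := by
    rcases hd a with h | h <;> simp [h]
  have hsum : ∑ a, (S.deg a + (if S.deg a = 5 then 1 else 0)) = 6 * Fintype.card Φ := by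
    simp [hdeg, mul_comm]
  rw [Finset.sum_add_distrib, sum_deg, ← Finset.card_filter] at hsum
  have := S.euler
  omega

end CubicSphere

/-! ### The covering by `D k` -/

namespace DVertex

variable {k : ℕ}

/-- The list of the facets that meet at a vertex of `D k`, in the order of `DVertex.facets`. -/
def fct : DVertex k → Fin 3 → DFacet k
  | .top i => ![.top, .ring 0 i, .ring 0 (i + 1)]
  | .zig j i => ![.ring j.castSucc i, .ring j.castSucc (i + 1), .ring j.succ i]
  | .zag j i => ![.ring j.castSucc (i + 1), .ring j.succ i, .ring j.succ (i + 1)]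
  | .bottom i => ![.ring (Fin.last (k + 1)) i, .ring (Fin.last (k + 1)) (i + 1), .bottom]

/-- The end of the edge that leaves the facet `u.fct t` at `u`, with the number of the facet that
the edge meets there. -/
def nbr : DVertex k → Fin 3 → DVertex k × Fin 3
  | .top i => ![(.zig 0 i, 2), (.top (i + 1), 2), (.top (i - 1), 1)]
  | .zig j i => ![(.zag j i, 2), (.zag j (i - 1), 1),
      Fin.cases (.top i, 0) (fun j' => (.zag j'.castSucc i, 0)) j]
  | .zag j i => ![Fin.lastCases (.bottom i, 2) (fun j' => (.zig j'.succ i, 2)) j,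
      (.zig j (i + 1), 1), (.zig j i, 0)]
  | .bottom i => ![(.bottom (i + 1), 1), (.bottom (i - 1), 0), (.zag (Fin.last k) i, 0)]

theorem mem_facets_iff (u : DVertex k) (A : DFacet k) : A ∈ u.facets ↔ ∃ t, u.fct t = A := by
  cases u <;> simp [facets, fct, Fin.exists_fin_succ, eq_comm]

theorem nbr_nbr (u : DVertex k) (t : Fin 3) : nbr (u.nbr t).1 (u.nbr t).2 = (u, t) := by
  rcases u with i | ⟨j, i⟩ | ⟨j, i⟩ | i
  · fin_cases t <;> simp [nbr]
  · cases j using Fin.cases <;> fin_cases t <;> simp [nbr]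
  · cases j using Fin.lastCases <;> fin_cases t <;> simp [nbr]
  · fin_cases t <;> simp [nbr]

theorem exists_fct_nbr_eq (u : DVertex k) {s t : Fin 3} (hs : s ≠ t) :
    ∃ s', s' ≠ (u.nbr t).2 ∧ fct (u.nbr t).1 s' = u.fct s := by
  revert s t
  rcases u with i | ⟨j, i⟩ | ⟨j, i⟩ | i
  · simp [Fin.forall_fin_succ, Fin.exists_fin_succ, nbr, fct]
  · cases j using Fin.cases <;> simp [Fin.forall_fin_succ, Fin.exists_fin_succ, nbr, fct]
  · cases j using Fin.lastCases <;> simp [Fin.forall_fin_succ, Fin.exists_fin_succ, nbr, fct]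
  · simp [Fin.forall_fin_succ, Fin.exists_fin_succ, nbr, fct]

theorem eq_of_facets_subset {u v : DVertex k} (h : u.facets ⊆ v.facets) : u = v := by
  have hindex : ∀ i i' : ZMod 5, (i = i' ∨ i = i' + 1) → (i + 1 = i' ∨ i + 1 = i' + 1) →
      i = i' := by decide
  have hsucc : ∀ i : ZMod 5, i + 1 ≠ i := by decide
  rcases u with i | ⟨j, i⟩ | ⟨j, i⟩ | i <;> rcases v with i' | ⟨j', i'⟩ | ⟨j', i'⟩ | i' <;>
    simp only [facets, Set.insert_subset_iff, Set.singleton_subset_iff, Set.mem_insert_iff,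
      Set.mem_singleton_iff, DFacet.ring.injEq, reduceCtorEq, false_or, or_false, false_and,
      and_false, true_and, Fin.ext_iff, Fin.val_castSucc, Fin.val_succ, Fin.val_last,
      Fin.val_zero] at h <;> grind

end DVertex

theorem DFacet.exists_fct_eq {k : ℕ} (A : DFacet k) :
    ∃ (u : DVertex k) (t : Fin 3), u.fct t = A := by
  rcases A with _ | ⟨j, i⟩ | _
  · exact ⟨.top 0, 0, rfl⟩
  · cases j using Fin.cases with
    | zero => exact ⟨.top i, 1, rfl⟩
    | succ j => exact ⟨.zig j i, 2, rfl⟩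
  · exact ⟨.bottom 0, 2, rfl⟩

namespace CubicSphere

variable {V Φ : Type*} [Fintype V] [Fintype Φ] [DecidableEq Φ] {S : CubicSphere V Φ}

namespace CappedRingChain

variable {k : ℕ} {c b : Φ} {R : ℕ → ZMod 5 → Φ}

/-- The map from the facets of `D k` to the facets of a sphere with a capped chain of rings. -/
def facetMap (k : ℕ) (c b : Φ) (R : ℕ → ZMod 5 → Φ) : DFacet k → Φ
  | .top => c
  | .ring j i => R j i
  | .bottom => b

theorem corner_facetMap (H : S.CappedRingChain k c b R) (u : DVertex k) :
    S.Corner (facetMap k c b R (u.fct 0)) (facetMap k c b R (u.fct 1))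
      (facetMap k c b R (u.fct 2)) := by
  rcases u with i | ⟨j, i⟩ | ⟨j, i⟩ | i
  · exact (H.top i).1
  · exact (H.ringPair j (by omega) i).1.swap_left
  · exact (H.ringPair j (by omega) i).2.2.1
  · exact (H.bottom i).1.rotate

theorem facetMap_fct_ne (H : S.CappedRingChain k c b R) (u : DVertex k) (t : Fin 3) :
    facetMap k c b R (u.fct t) ≠ facetMap k c b R ((u.nbr t).1.fct (u.nbr t).2) := by
  have hshift (i : ZMod 5) : i - 1 + 2 = i + 1 := by ring
  have hskip {a : Φ} {q : ZMod 5 → Φ} (h : S.IsRingAround a q) (i : ZMod 5) :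
      q i ≠ q (i + 1 + 1) ∧ q (i + 1) ≠ q (i - 1) := by
    have := (h (i - 1)).2.1.symm
    rw [hshift] at this
    exact ⟨by simpa only [add_assoc, one_add_one_eq_two] using (h i).2.1, this⟩
  have hzig (j : Fin (k + 1)) (i : ZMod 5) : R j i ≠ R (j + 1) (i + 1) :=
    (H.ringPair j (by omega) i).2.1
  have hzag (j : Fin (k + 1)) (i : ZMod 5) : R j (i + 1) ≠ R (j + 1) (i - 1) := by
    have := (H.ringPair j (by omega) (i - 1)).2.2.2.1.symm
    rwa [hshift] at this
  rcases u with i | ⟨j, i⟩ | ⟨j, i⟩ | i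
  · fin_cases t
    · exact (H.ne_top i).symm
    · exact (hskip H.top i).1
    · exact (hskip H.top i).2
  · fin_cases t
    · exact hzig j i
    · exact hzag j i
    · cases j using Fin.cases with
      | zero => exact H.ne_top i
      | succ j => exact H.ne j (by omega) i
  · fin_cases t
    · cases j using Fin.lastCases with
      | last => simpa [facetMap, DVertex.fct, DVertex.nbr] using H.ne_bottom (i + 1)
      | cast j => simpa [facetMap, DVertex.fct, DVertex.nbr] using (H.ne j (by omega) i).symm
    · simpa [facetMap, DVertex.fct, DVertex.nbr] using (hzag j (i + 1)).symm
    · exact (hzig j i).symm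
  · fin_cases t
    · exact (hskip H.bottom i).1
    · exact (hskip H.bottom i).2
    · exact (H.ne_bottom (i + 1)).symm

theorem exists_isCovering (H : S.CappedRingChain k c b R) :
    ∃ h, S.IsCovering DVertex.fct DVertex.nbr (facetMap k c b R) h := by
  choose h hh using H.corner_facetMap
  refine ⟨h, fun u => ?_, DVertex.nbr_nbr, DVertex.exists_fct_nbr_eq, H.facetMap_fct_ne⟩
  rw [hh]
  ext x
  simp [Fin.exists_fin_succ, eq_comm]

theorem surjective_facetMap (hd : S.IsFullerene) (H : S.CappedRingChain k c b R) :
    Function.Surjective (facetMap k c b R) := by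
  intro a
  obtain ⟨h, hh⟩ := H.exists_isCovering
  have : Nonempty (DVertex k) := ⟨.top 0⟩
  have hpos : 0 < S.deg a := by rcases hd a with h5 | h6 <;> omega
  obtain ⟨v, hv⟩ := Finset.card_pos.1 hpos
  obtain ⟨u, rfl⟩ := hh.surjective v
  obtain ⟨t, ht⟩ := hh.exists_of_mem (Finset.mem_filter.1 hv).2
  exact ⟨_, ht⟩

/-- The twelve facets of `D k` in the two caps: for each side an end pentagon, numbered `none`, and
the ring around it. -/
def capFacet (k : ℕ) : Bool × Option (ZMod 5) → DFacet k
  | (true, none) => .top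
  | (true, some i) => .ring 0 i
  | (false, none) => .bottom
  | (false, some i) => .ring (Fin.last (k + 1)) i

theorem exists_capFacet_eq (H : S.CappedRingChain k c b R) {A : DFacet k}
    (hA : S.deg (facetMap k c b R A) = 5) : ∃ x, capFacet k x = A := by
  rcases A with _ | ⟨j, i⟩ | _
  · exact ⟨(true, none), rfl⟩
  · cases j using Fin.cases with
    | zero => exact ⟨(true, some i), rfl⟩
    | succ j =>
      cases j using Fin.lastCases with
      | last => exact ⟨(false, some i), rfl⟩
      | cast j =>
        have h6 := H.deg_eq_six j (by omega) i
        simp only [facetMap, Fin.val_succ, Fin.val_castSucc, h6] at hA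
        omega
  · exact ⟨(false, none), rfl⟩

theorem injective_facetMap_capFacet (hd : S.IsFullerene) (H : S.CappedRingChain k c b R) :
    Function.Injective fun x => facetMap k c b R (capFacet k x) := by
  have hsub : (Finset.univ.filter fun a => S.deg a = 5) ⊆
      Finset.univ.image fun x => facetMap k c b R (capFacet k x) := by
    intro a ha
    obtain ⟨A, rfl⟩ := H.surjective_facetMap hd a
    obtain ⟨x, rfl⟩ := H.exists_capFacet_eq (Finset.mem_filter.1 ha).2
    exact Finset.mem_image_of_mem _ (Finset.mem_univ x)
  have hle := Finset.card_le_card hsub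
  rw [hd.card_pentagons] at hle
  have hcard : (Finset.univ : Finset (Bool × Option (ZMod 5))).card = 12 := rfl
  have hinj := Finset.injOn_of_card_image_eq (Finset.card_image_le.antisymm (hcard.trans_le hle))
  rwa [Finset.coe_univ, Set.injOn_univ] at hinj

theorem eq_of_facetMap_eq (hd : S.IsFullerene) (H : S.CappedRingChain k c b R) {A B : DFacet k}
    (hA : S.deg (facetMap k c b R A) = 5) (h : facetMap k c b R A = facetMap k c b R B) :
    A = B := by
  obtain ⟨x, rfl⟩ := H.exists_capFacet_eq hA
  obtain ⟨y, rfl⟩ := H.exists_capFacet_eq (h ▸ hA)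
  exact congrArg _ (H.injective_facetMap_capFacet hd h)

theorem exists_bijective (hd : S.IsFullerene) (H : S.CappedRingChain k c b R) :
    ∃ h : DVertex k → V, Function.Bijective h ∧
      ∀ u A, facetMap k c b R A ∈ S.N (h u) ↔ A ∈ u.facets := by
  obtain ⟨h, hh⟩ := H.exists_isCovering
  have : Nonempty (DVertex k) := ⟨.top 0⟩
  have hdeg (t : Fin 3) : S.deg (facetMap k c b R (DVertex.fct (.top 0) t)) = 5 := by
    fin_cases t
    · exact H.deg_top
    · exact H.deg_first _
    · exact H.deg_first _
  have hfibre : ∀ u ∈ h ⁻¹' {h (.top 0)}, u = .top 0 := by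
    refine fun u hu => DVertex.eq_of_facets_subset fun A hA => ?_
    obtain ⟨t, rfl⟩ := (u.mem_facets_iff A).1 hA
    have hmem := hh.mem u t
    rw [Set.mem_preimage.1 hu] at hmem
    obtain ⟨s, hs⟩ := hh.exists_of_mem hmem
    exact (DVertex.mem_facets_iff _ _).2 ⟨s, H.eq_of_facetMap_eq hd (hdeg s) hs⟩
  have hinj := hh.injective fun u hu u' hu' => (hfibre u hu).trans (hfibre u' hu').symm
  exact ⟨h, ⟨hinj, hh.surjective⟩, fun u A => by
    rw [hh.mem_iff hinj A.exists_fct_eq, DVertex.mem_facets_iff]⟩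

end CappedRingChain

end CubicSphere

/-! ### Incidence structures of polytopes -/

theorem combEquiv_of_mem_iff {V Φ U Ψ : Type*} {F : Φ → Set V} {G : Ψ → Set U} {g : Ψ → Φ}
    {h : U → V} (hg : Function.Surjective g) (hh : Function.Bijective h)
    (hmem : ∀ u A, h u ∈ F (g A) ↔ u ∈ G A) :
    CombEquiv (facesOf Set.univ F) (facesOf Set.univ G) := by
  have hG (A : Ψ) : h ⁻¹' F (g A) = G A := Set.ext fun u => hmem u A
  refine ⟨OrderIso.symm (RelIso.ofSurjective (OrderEmbedding.ofMapLEIff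
    (fun X : facesOf Set.univ G => (⟨h '' X.1, ?_⟩ : facesOf Set.univ F)) ?_) ?_)⟩
  · obtain ⟨T, hT⟩ := X.2
    refine ⟨g '' T, ?_⟩
    rw [← Set.image_preimage_eq (Set.univ ∩ _) hh.2, hT]
    simp [Set.preimage_iInter, hG]
  · exact fun X Y => Set.image_subset_image_iff hh.1
  · rintro ⟨Y, T, hT⟩
    refine ⟨⟨h ⁻¹' Y, g ⁻¹' T, ?_⟩, Subtype.ext (Set.image_preimage_eq _ hh.2)⟩
    ext u
    simp only [hT, Set.univ_inter, Set.mem_preimage, Set.mem_iInter, ← hmem]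
    exact hg.forall

section FacesOf

variable {V Φ U Ψ : Type*} {F : Φ → Set V} {G : Ψ → Set U}

variable (F) in
theorem univ_mem_facesOf : Set.univ ∈ facesOf Set.univ F := ⟨∅, by simp⟩

variable (F) in
theorem facet_mem_facesOf (i : Φ) : F i ∈ facesOf Set.univ F := ⟨{i}, by simp⟩

theorem exists_subset_of_mem_facesOf {X : Set V} (hX : X ∈ facesOf Set.univ F)
    (hne : X ≠ Set.univ) : ∃ i, X ⊆ F i := by
  obtain ⟨T, rfl⟩ := hX
  rcases T.eq_empty_or_nonempty with rfl | ⟨i, hi⟩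
  · simp at hne
  · exact ⟨i, fun x hx => Set.mem_iInter₂.1 hx.2 i hi⟩

end FacesOf

/-- The facets `F i`, given by their sets of vertices, are the maximal proper faces, and the
vertices are the minimal nonempty faces. -/
structure IsIncidence {V Φ : Type*} (F : Φ → Set V) : Prop where
  exists_notMem : ∀ v, ∃ i, v ∉ F i
  eq_of_mem : ∀ v w, (∀ i, v ∈ F i → w ∈ F i) → v = w
  eq_of_subset : ∀ i j, F i ⊆ F j → i = j
  ne_univ : ∀ i, F i ≠ Set.univ

namespace IsIncidence

variable {V Φ U Ψ : Type*} {F : Φ → Set V} {G : Ψ → Set U}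

theorem singleton_mem_facesOf (hF : IsIncidence F) (v : V) : {v} ∈ facesOf Set.univ F := by
  refine ⟨{i | v ∈ F i}, ?_⟩
  ext w
  simp only [Set.mem_singleton_iff, Set.univ_inter, Set.mem_iInter, Set.mem_ofPred_eq]
  exact ⟨fun h => h ▸ fun _ => id, fun h => (hF.eq_of_mem v w h).symm⟩

theorem empty_mem_facesOf (hF : IsIncidence F) : ∅ ∈ facesOf Set.univ F := by
  refine ⟨Set.univ, ?_⟩
  ext w
  simpa using hF.exists_notMem w

variable (e : facesOf Set.univ F ≃o facesOf Set.univ G)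

theorem map_nonempty (hF : IsIncidence F) {X : facesOf Set.univ F} (hX : X.1.Nonempty) :
    (e X).1.Nonempty := by
  rw [Set.nonempty_iff_ne_empty]
  intro he
  have hle : e X ≤ e ⟨∅, hF.empty_mem_facesOf⟩ := he.subset.trans (Set.empty_subset _)
  have hsub : X.1 ⊆ ∅ := e.le_iff_le.1 hle
  exact hX.ne_empty (Set.subset_empty_iff.1 hsub)

theorem map_ne_univ {X : facesOf Set.univ F} (hX : X.1 ≠ Set.univ) : (e X).1 ≠ Set.univ := by
  intro he
  have hle : e ⟨Set.univ, univ_mem_facesOf F⟩ ≤ e X := (Set.subset_univ _).trans he.superset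
  have hsub : Set.univ ⊆ X.1 := e.le_iff_le.1 hle
  exact hX (Set.univ_subset_iff.1 hsub)

theorem exists_map_singleton_eq (hF : IsIncidence F) (hG : IsIncidence G) (v : V) :
    ∃ u, e ⟨{v}, hF.singleton_mem_facesOf v⟩ = ⟨{u}, hG.singleton_mem_facesOf u⟩ := by
  obtain ⟨u, hu⟩ := map_nonempty e hF (X := ⟨{v}, hF.singleton_mem_facesOf v⟩)
    (Set.singleton_nonempty v)
  refine ⟨u, ?_⟩
  rw [← e.eq_symm_apply]
  have hle : e.symm ⟨{u}, hG.singleton_mem_facesOf u⟩ ≤ ⟨{v}, hF.singleton_mem_facesOf v⟩ :=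
    e.symm_apply_le.2 (Set.singleton_subset_iff.2 hu)
  have hne := map_nonempty e.symm hG (X := ⟨{u}, hG.singleton_mem_facesOf u⟩)
    (Set.singleton_nonempty u)
  exact Subtype.ext ((Set.subset_singleton_iff_eq.1 hle).resolve_left hne.ne_empty).symm

theorem exists_map_facet_eq (hF : IsIncidence F) (hG : IsIncidence G) (i : Φ) :
    ∃ j, e ⟨F i, facet_mem_facesOf F i⟩ = ⟨G j, facet_mem_facesOf G j⟩ := by
  obtain ⟨j, hj⟩ := exists_subset_of_mem_facesOf (e ⟨F i, facet_mem_facesOf F i⟩).2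
    (map_ne_univ e (hF.ne_univ i))
  obtain ⟨i', hi'⟩ := exists_subset_of_mem_facesOf (e.symm ⟨G j, facet_mem_facesOf G j⟩).2
    (map_ne_univ e.symm (hG.ne_univ j))
  have hle : ⟨F i, facet_mem_facesOf F i⟩ ≤ e.symm ⟨G j, facet_mem_facesOf G j⟩ :=
    e.le_symm_apply.2 hj
  obtain rfl := hF.eq_of_subset i i' (Set.Subset.trans hle hi')
  exact ⟨j, e.eq_symm_apply.1 (le_antisymm hle hi')⟩

theorem exists_of_combEquiv (hF : IsIncidence F) (hG : IsIncidence G)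
    (h : CombEquiv (facesOf Set.univ F) (facesOf Set.univ G)) :
    ∃ (g : Φ → Ψ) (f : V → U), Function.Injective g ∧ Function.Bijective f ∧
      ∀ v i, f v ∈ G (g i) ↔ v ∈ F i := by
  obtain ⟨e⟩ := h
  choose f hf using exists_map_singleton_eq e hF hG
  choose f' hf' using exists_map_singleton_eq e.symm hG hF
  choose g hg using exists_map_facet_eq e hF hG
  refine ⟨g, f, fun i j hij => ?_, ⟨fun v w hvw => ?_, fun u => ⟨f' u, ?_⟩⟩, fun v i => ?_⟩
  · have heq := e.injective ((hg i).trans ((Subtype.ext (by rw [hij])).trans (hg j).symm))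
    exact hF.eq_of_subset i j (congrArg Subtype.val heq).subset
  · have heq := e.injective ((hf v).trans ((Subtype.ext (by rw [hvw])).trans (hf w).symm))
    exact Set.singleton_injective (congrArg Subtype.val heq)
  · have heq := (hf (f' u)).symm.trans (e.symm_apply_eq.1 (hf' u)).symm
    exact Set.singleton_injective (congrArg Subtype.val heq)
  · have hle := e.le_iff_le (x := ⟨{v}, hF.singleton_mem_facesOf v⟩)
      (y := ⟨F i, facet_mem_facesOf F i⟩)
    rw [hf, hg] at hle
    simpa using hle

end IsIncidence

theorem CubicSphere.isIncidence {V Φ : Type*} [Fintype V] [Fintype Φ] [DecidableEq Φ]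
    (S : CubicSphere V Φ) (hF : ∀ i, ∃ v, i ∈ S.N v) : IsIncidence fun i => {v | i ∈ S.N v} where
  exists_notMem v := by
    obtain ⟨a, ha⟩ : (S.N v).Nonempty := Finset.card_pos.1 (by rw [S.card_N]; norm_num)
    obtain ⟨w, hw, -⟩ := S.existsUnique_nbr v a ha
    obtain ⟨b, hb⟩ := exists_sdiff_eq_singleton_symm hw
    exact ⟨b, (Finset.mem_sdiff.1 (hb ▸ Finset.mem_singleton_self b)).2⟩
  eq_of_mem v w h := S.N_injective (Finset.eq_of_subset_of_card_le (fun i hi => h i hi)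
    (by rw [S.card_N, S.card_N]))
  eq_of_subset i j h := by
    obtain ⟨v, hv⟩ := hF i
    obtain ⟨w, hw, -⟩ := S.existsUnique_nbr v j (h hv)
    have hjw : j ∉ S.N w := (Finset.mem_sdiff.1 (hw ▸ Finset.mem_singleton_self j)).2
    have hiw : i ∉ S.N w := fun hi => hjw (h hi)
    exact Finset.mem_singleton.1 (hw ▸ Finset.mem_sdiff.2 ⟨hv, hiw⟩)
  ne_univ i h := by
    obtain ⟨v, hv⟩ := hF i
    obtain ⟨w, hw, -⟩ := S.existsUnique_nbr v i hv
    exact (Finset.mem_sdiff.1 (hw ▸ Finset.mem_singleton_self i)).2 (h.superset (Set.mem_univ w))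

theorem DFacet.exists_inter_facets_subset {k : ℕ} (A : DFacet k) :
    ∃ u v : DVertex k, A ∈ u.facets ∧ A ∈ v.facets ∧ u.facets ∩ v.facets ⊆ {A} := by
  have : ∀ i : ZMod 5, i - 1 ≠ i ∧ i - 1 ≠ i + 1 := by decide
  have : (0 : ZMod 5) ≠ 2 ∧ (1 : ZMod 5) ≠ 2 ∧ (0 : ZMod 5) ≠ 2 + 1 ∧
    (1 : ZMod 5) ≠ 2 + 1 := by decide
  rcases A with _ | ⟨j, i⟩ | _
  · refine ⟨.top 0, .top 2, by simp [DVertex.facets], by simp [DVertex.facets], ?_⟩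
    rintro B ⟨hB, hB'⟩
    simp only [DVertex.facets, Set.mem_insert_iff, Set.mem_singleton_iff] at hB hB' ⊢
    grind
  · cases j using Fin.cases with
    | zero =>
      refine ⟨.top (i - 1), .zig 0 i, by simp [DVertex.facets], by simp [DVertex.facets], ?_⟩
      rintro B ⟨hB, hB'⟩
      simp only [DVertex.facets, Set.mem_insert_iff, Set.mem_singleton_iff] at hB hB' ⊢
      grind
    | succ j =>
      refine ⟨.zag j (i - 1), .zag j i, by simp [DVertex.facets], by simp [DVertex.facets], ?_⟩
      rintro B ⟨hB, hB'⟩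
      simp only [DVertex.facets, Set.mem_insert_iff, Set.mem_singleton_iff] at hB hB' ⊢
      grind
  · refine ⟨.bottom 0, .bottom 2, by simp [DVertex.facets], by simp [DVertex.facets], ?_⟩
    rintro B ⟨hB, hB'⟩
    simp only [DVertex.facets, Set.mem_insert_iff, Set.mem_singleton_iff] at hB hB' ⊢
    grind

theorem DFacet.eq_of_vertices_subset {k : ℕ} {A B : DFacet k} (h : A.vertices ⊆ B.vertices) :
    A = B := by
  obtain ⟨u, v, hu, hv, huv⟩ := A.exists_inter_facets_subset
  exact (huv ⟨h hu, h hv⟩).symm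

theorem DFacet.isIncidence_vertices (k : ℕ) : IsIncidence (DFacet.vertices (k := k)) where
  exists_notMem v := by
    rcases v with i | ⟨j, i⟩ | ⟨j, i⟩ | i
    · exact ⟨.bottom, by simp [DFacet.vertices, DVertex.facets]⟩
    all_goals exact ⟨.top, by simp [DFacet.vertices, DVertex.facets]⟩
  eq_of_mem _ _ h := DVertex.eq_of_facets_subset h
  eq_of_subset _ _ := DFacet.eq_of_vertices_subset
  ne_univ A h := by
    have htop : top = A := DFacet.eq_of_vertices_subset (h ▸ Set.subset_univ _)
    have hbottom : bottom = A := DFacet.eq_of_vertices_subset (h ▸ Set.subset_univ _)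
    cases htop.trans hbottom.symm

theorem DFacet.ncard_vertices_top (k : ℕ) : (DFacet.top : DFacet k).vertices.ncard = 5 := by
  have hrange : (DFacet.top : DFacet k).vertices = Set.range DVertex.top := by
    ext u
    cases u <;> simp [DFacet.vertices, DVertex.facets]
  rw [hrange, ← Set.image_univ, Set.ncard_image_of_injective _ fun _ _ => DVertex.top.inj]
  simp

theorem DFacet.ncard_vertices_ring_zero (k : ℕ) (i : ZMod 5) :
    (DFacet.ring 0 i : DFacet k).vertices.ncard = 5 := by
  have hsucc (i' : ZMod 5) : i = i' + 1 ↔ i' = i - 1 := by rw [eq_sub_iff_add_eq, eq_comm]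
  have hvertices : (DFacet.ring 0 i : DFacet k).vertices =
      {.top i, .top (i - 1), .zig 0 i, .zig 0 (i - 1), .zag 0 (i - 1)} := by
    ext u
    rcases u with i' | ⟨j, i'⟩ | ⟨j, i'⟩ | i'
    · simp [DFacet.vertices, DVertex.facets, hsucc, eq_comm]
    · cases j using Fin.cases <;>
        simp [DFacet.vertices, DVertex.facets, hsucc, eq_comm, Fin.ext_iff]
    · cases j using Fin.cases <;>
        simp [DFacet.vertices, DVertex.facets, hsucc, eq_comm, Fin.ext_iff]
    · simp [DFacet.vertices, DVertex.facets, Fin.ext_iff]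
  have hpred : i ≠ i - 1 := (by decide : ∀ i : ZMod 5, i ≠ i - 1) i
  rw [hvertices]
  repeat rw [Set.ncard_insert_of_notMem (by simp [hpred])]
  simp

/-! ### Fullerenes -/

theorem CubicSphere.exists_combEquiv_DFaces {V Φ : Type*} [Fintype V] [Fintype Φ] [DecidableEq Φ]
    {S : CubicSphere V Φ} {c : Φ} {p : ZMod 5 → Φ} (hd : S.IsFullerene) (hc : S.deg c = 5)
    (hp : ∀ i, S.deg (p i) = 5) (hinj : Function.Injective p) (hpc : ∀ i, p i ≠ c)
    (hcp : ∀ i, ∃ v, c ∈ S.N v ∧ p i ∈ S.N v) :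
    ∃ k, CombEquiv (facesOf Set.univ fun i => {v | i ∈ S.N v}) (DFaces k) := by
  obtain ⟨q, hq, hrange⟩ := exists_isRingAround hc
  choose v hcv hpv using hcp
  choose r hr using fun i => hrange (v i) (p i) (hcv i) (hpv i) (hpc i)
  have hrinj : Function.Injective r := fun i j hij => hinj (by rw [← hr, ← hr, hij])
  have hq5 (j : ZMod 5) : S.deg (q j) = 5 := by
    obtain ⟨i, rfl⟩ := Finite.surjective_of_injective hrinj j
    rw [hr, hp]
  obtain ⟨k, b, R, H⟩ := hq.exists_cappedRingChain hd hc hq5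
  obtain ⟨h, hh, hmem⟩ := H.exists_bijective hd
  exact ⟨k, combEquiv_of_mem_iff (H.surjective_facetMap hd) hh hmem⟩

namespace ConvexPolytope

variable {P : ConvexPolytope 3}

theorem isGon_iff_ncard {s : ℕ} {i : Fin P.m} :
    P.IsGon s i ↔ {v : P.Vertex | i ∈ P.tight v}.ncard = s := by
  rw [IsGon, ← Set.ncard_image_of_injective _ Subtype.val_injective]
  have heq : {v | P.IsVertex v ∧ v ∈ P.facet i} =
      Subtype.val '' {v : P.Vertex | i ∈ P.tight v} := by
    ext v
    simp only [mem_facet, Set.mem_ofPred_eq, Set.mem_image, Subtype.exists, exists_and_right,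
      exists_eq_right]
    exact ⟨fun h => ⟨h.1, h.2.2⟩, fun ⟨h, hi⟩ => ⟨h, h.mem_carrier, hi⟩⟩
  rw [heq]

theorem IsSimple.isGon_iff_deg (hs : P.IsSimple) {s : ℕ} {i : Fin P.m} :
    P.IsGon s i ↔ hs.toCubicSphere.deg i = s := by
  rw [isGon_iff_ncard, CubicSphere.deg, ← Set.ncard_coe_finset, Finset.coe_filter_univ]
  rfl

theorem IsFullerene.exists_combEquiv_of_containsCap (hP : P.IsFullerene) (h : P.ContainsCap) :
    ∃ k, CombEquiv P.faces (DFaces k) := by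
  obtain ⟨hs, hgon⟩ := hP
  obtain ⟨c, p, hc, hp, hinj, hpc, hcp, -⟩ := h
  simp only [hs.isGon_iff_deg] at hgon hc hp
  obtain ⟨k, ⟨e⟩⟩ := CubicSphere.exists_combEquiv_DFaces hgon hc hp hinj hpc
    fun i => (hcp i).exists_vertex
  obtain ⟨e'⟩ := P.combEquiv_vertices
  exact ⟨k, ⟨e'.trans e⟩⟩

theorem IsSimple.containsCap_of_combEquiv (hs : P.IsSimple) {k : ℕ}
    (h : CombEquiv P.faces (DFaces k)) : P.ContainsCap := by
  obtain ⟨e⟩ := h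
  obtain ⟨e'⟩ := P.combEquiv_vertices
  obtain ⟨g, f, hg, hf, hmem⟩ := (DFacet.isIncidence_vertices k).exists_of_combEquiv
    (hs.toCubicSphere.isIncidence P.exists_vertex_mem_tight) ⟨e.symm.trans e'⟩
  have hpentagon (A : DFacet k) (hA : A.vertices.ncard = 5) : P.IsGon 5 (g A) := by
    rw [isGon_iff_ncard, ← hA, ← Set.ncard_image_of_injective _ hf.1]
    congr 1
    ext v
    obtain ⟨u, rfl⟩ := hf.2 v
    rw [hf.1.mem_set_image]
    exact hmem u A
  have hedge {A B : DFacet k} (hAB : A ≠ B) (u : DVertex k) (hA : A ∈ u.facets)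
      (hB : B ∈ u.facets) : P.IsEdge (P.facet (g A) ∩ P.facet (g B)) :=
    hs.isEdge_facet_inter_facet (hg.ne hAB) ((hmem u A).2 hA) ((hmem u B).2 hB)
  have hone : (1 : ZMod 5) ≠ 0 := by decide
  refine ⟨g .top, fun i => g (.ring 0 i), hpentagon _ (DFacet.ncard_vertices_top k),
    fun i => hpentagon _ (DFacet.ncard_vertices_ring_zero k i),
    fun i j hij => (DFacet.ring.inj (hg hij)).2, fun i => hg.ne nofun,
    fun i => hedge nofun (.top i) (by simp [DVertex.facets]) (by simp [DVertex.facets]),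
    fun i => hedge (by simp [hone]) (.top i) (by simp [DVertex.facets]) (by simp [DVertex.facets])⟩

end ConvexPolytope

theorem mainTheorem6 (P : ConvexPolytope 3) (hP : P.IsFullerene) :
    (∃ k : ℕ, CombEquiv P.faces (DFaces k)) ↔ P.ContainsCap :=
  ⟨fun ⟨_, h⟩ => hP.1.containsCap_of_combEquiv h, hP.exists_combEquiv_of_containsCap⟩
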